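/- **Setting.** Let $I\subseteq\mathbb{R}$ be a non-empty open interval unbounded below, i.e. $I=(-\infty,T)$ with $T\le\infty$, and consider the flat FLRW spacetime $I\times\mathbb{R}^3$ with metric $g=-dt^2+a(t)^2(dx^2+dy^2+dz^2)$, $a>0$. Assume it is asymptotically de Sitter in the past: $a(t)\sim\bar a\,e^{H_\Lambda t}$ as $t\to-\infty$ for some constants $\bar a,H_\Lambda>0$ (the ratio of the two sides tends to $1$). Write $H=\dot a/a$, let $\lambda(t)=\int_{-\infty}^t a(t')\,dt'$ be the affine parameter along the incomplete null geodesics, and regard $\dot H/a^2$ as a function of $\lambda$. Let $\mathscr{B}^-$ be the past boundary $t\to-\infty$ (equivalently $a\to0$, $\lambda\to0^+$). **Definitions.** For an integer $r\ge0$ and $a$ of class $C^{r+2}$, $\mathscr{B}^-$ is a *$C^r$ p.p. curvature singularity* if there are an affinely parametrized null geodesic $\gamma:(0,b)\to I\times\mathbb{R}^3$, $0<b<\infty$, with $t(\gamma(s))\to-\infty$ as $s\to0^+$, and a parallelly propagated orthonormal tetrad along $\gamma$, such that some component in this tetrad of the $r$-th covariant derivative of the Riemann tensor has no finite limit as $s\to0^+$.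 The spacetime is *$C^r$ inextendible* if $\mathscr{B}^-$ is a $C^r$ p.p. curvature singularity, and *$C^r$ extendible* otherwise; it is *$C^\infty$ extendible* if it is $C^r$ extendible for every $r\ge0$. **Theorem.** Let $r\ge0$ be an integer and let $a$ be of class $C^{r+2}$. 1. If $\big|\partial_\lambda^r(\dot H/a^2)\big|\to\infty$ as $\lambda\to0^+$, then $\mathscr{B}^-$ is a $C^r$ p.p. curvature singularity and the spacetime is $C^r$ inextendible. 2. If $\partial_\lambda^r(\dot H/a^2)$ has a finite limit as $\lambda\to0^+$, then $\mathscr{B}^-$ is not a $C^r$ p.p. curvature singularity and the spacetime is $C^r$ extendible. Consequently: 3. If $a$ is $C^\infty$ and $\dot H\sim a^q$ as $a\to0$ for an integer $q\ge2$, in the sense that $\dot H(t)=a(t)^q f(a(t))$ for all sufficiently negative $t$, where $f$ is a function that is $C^\infty$ at $0$ (for example a constant, giving an exact power law), then the spacetime is $C^\infty$ extendible. -/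

import Mathlib

open Set Filter Topology MeasureTheory Asymptotics
open scoped ContDiff

noncomputable section

namespace FLRW

/-! Tensor calculus for a metric given in a global coordinate chart of (a region of) `ℝ⁴`.
A point is `x : Fin 4 → ℝ`, where `x 0 = t` is the time coordinate. -/

/-- A Lorentzian metric in coordinates: the matrix of components `g_{ij}(x)`. -/
abbrev CoordMetric := (Fin 4 → ℝ) → Matrix (Fin 4) (Fin 4) ℝ

/-- A covariant tensor field of rank `n` in coordinates: `T J x` is the component
`T_{J 0, …, J (n-1)}` at the point `x`. -/
abbrev CovTensor (n : ℕ) := (Fin n → Fin 4) → (Fin 4 → ℝ) → ℝ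

/-- The partial derivative `∂_i f` at `x`. -/
def pd (i : Fin 4) (f : (Fin 4 → ℝ) → ℝ) (x : Fin 4 → ℝ) : ℝ :=
  fderiv ℝ f x (Pi.single i 1)

/-- Christoffel symbols `Γ^k_{ij} = ½ g^{kl} (∂_i g_{jl} + ∂_j g_{il} - ∂_l g_{ij})`. -/
def christoffel (g : CoordMetric) (k i j : Fin 4) (x : Fin 4 → ℝ) : ℝ :=
  (1 / 2) * ∑ l, (g x)⁻¹ k l *
    (pd i (fun y => g y j l) x + pd j (fun y => g y i l) x - pd l (fun y => g y i j) x)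

/-- The curvature
`R^l_{kij} = ∂_i Γ^l_{jk} - ∂_j Γ^l_{ik} + Γ^l_{im} Γ^m_{jk} - Γ^l_{jm} Γ^m_{ik}`. -/
def riemannUp (g : CoordMetric) (l k i j : Fin 4) (x : Fin 4 → ℝ) : ℝ :=
  pd i (christoffel g l j k) x - pd j (christoffel g l i k) x +
    ∑ m, (christoffel g l i m x * christoffel g m j k x -
      christoffel g l j m x * christoffel g m i k x)

/-- The Riemann tensor with all indices lowered, `R_{lkij} = g_{lm} R^m_{kij}`. -/
def riemann (g : CoordMetric) : CovTensor 4 := fun J x =>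
  ∑ m, g x (J 0) m * riemannUp g m (J 1) (J 2) (J 3) x

/-- The covariant derivative of a covariant tensor field; the first index is the direction of
differentiation:
`(∇T)_{i j₁…jₙ} = ∂_i T_{j₁…jₙ} - ∑_m Γ^k_{i j_m} T_{j₁…k…jₙ}` (`k` in the `m`-th slot). -/
def covDeriv (g : CoordMetric) {n : ℕ} (T : CovTensor n) : CovTensor (n + 1) := fun J x =>
  pd (J 0) (T (Fin.tail J)) x -
    ∑ m : Fin n, ∑ k : Fin 4,
      christoffel g k (J 0) (Fin.tail J m) x * T (Function.update (Fin.tail J) m k) x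

/-- The `r`-th covariant derivative of the Riemann tensor. -/
def iterCovDerivRiemann (g : CoordMetric) : (r : ℕ) → CovTensor (4 + r)
  | 0 => riemann g
  | r + 1 => covDeriv g (iterCovDerivRiemann g r)

/-- The inner product `g_x(v, w)`. -/
def metricProd (g : CoordMetric) (x v w : Fin 4 → ℝ) : ℝ :=
  ∑ i, ∑ j, g x i j * v i * w j

/-- The vector field `X` along the curve `γ` is parallel over the parameter set `S`:
`dX^k/ds + Γ^k_{ij} (dγ^i/ds) X^j = 0`. -/
def IsParallelOn (g : CoordMetric) (γ X : ℝ → Fin 4 → ℝ) (S : Set ℝ) : Prop :=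
  ∀ s ∈ S, HasDerivAt X
    (fun k => -∑ i, ∑ j, christoffel g k i j (γ s) * deriv γ s i * X s j) s

/-- `γ`, restricted to the parameter set `S`, is an affinely parametrized null geodesic contained
in the region `U`. -/
structure IsNullGeodesicOn (g : CoordMetric) (U : Set (Fin 4 → ℝ)) (γ : ℝ → Fin 4 → ℝ)
    (S : Set ℝ) : Prop where
  mem : ∀ s ∈ S, γ s ∈ U
  differentiable : ∀ s ∈ S, DifferentiableAt ℝ γ s
  geodesic : IsParallelOn g γ (deriv γ) S
  null : ∀ s ∈ S, metricProd g (γ s) (deriv γ s) (deriv γ s) = 0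

/-- The Minkowski metric `η = diag(-1, 1, 1, 1)`. -/
def minkowski : Matrix (Fin 4) (Fin 4) ℝ := Matrix.diagonal ![-1, 1, 1, 1]

/-- `E 0, …, E 3` is a parallelly propagated (orthonormal) tetrad along `γ` over `S`. -/
structure IsPPTetradOn (g : CoordMetric) (γ : ℝ → Fin 4 → ℝ) (E : Fin 4 → ℝ → Fin 4 → ℝ)
    (S : Set ℝ) : Prop where
  parallel : ∀ A, IsParallelOn g γ (E A) S
  orthonormal : ∀ s ∈ S, ∀ A B, metricProd g (γ s) (E A s) (E B s) = minkowski A B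

/-- The component `T(e_{A 0}, …, e_{A (n-1)})` of the tensor `T` at `x` in the frame `e`, which is
the coefficient of `e^{A 0} ⊗ ⋯ ⊗ e^{A (n-1)}` in the expansion of `T` in the dual frame. -/
def frameComponent {n : ℕ} (T : CovTensor n) (x : Fin 4 → ℝ) (e : Fin 4 → Fin 4 → ℝ)
    (A : Fin n → Fin 4) : ℝ :=
  ∑ J : Fin n → Fin 4, T J x * ∏ m, e (A m) (J m)

/-- The spacetime `(U, g)` has a `C^r` parallelly propagated curvature singularity at the boundary
that is approached along the filter `ℬ`: there are a null geodesic in `U` that reaches the boundary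
at a finite value (here `0`) of its affine parameter and a p.p. tetrad along it in which some
component of the `r`-th covariant derivative of the Riemann tensor has no finite limit at the
boundary. -/
def IsPPCurvatureSingularity (g : CoordMetric) (U : Set (Fin 4 → ℝ)) (ℬ : Filter (Fin 4 → ℝ))
    (r : ℕ) : Prop :=
  ∃ (b : ℝ) (γ : ℝ → Fin 4 → ℝ) (E : Fin 4 → ℝ → Fin 4 → ℝ),
    0 < b ∧ IsNullGeodesicOn g U γ (Ioo 0 b) ∧ Tendsto γ (𝓝[>] 0) ℬ ∧
    IsPPTetradOn g γ E (Ioo 0 b) ∧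
    ∃ A : Fin (4 + r) → Fin 4, ¬ ∃ L : ℝ,
      Tendsto (fun s => frameComponent (iterCovDerivRiemann g r) (γ s) (fun M => E M s) A)
        (𝓝[>] 0) (𝓝 L)

/-- `C^r` extendibility through the boundary `ℬ` means that there is no `C^r` p.p. curvature
singularity at `ℬ`; `C^r` inextendibility is its negation. -/
def IsExtendible (g : CoordMetric) (U : Set (Fin 4 → ℝ)) (ℬ : Filter (Fin 4 → ℝ))
    (r : ℕ) : Prop :=
  ¬ IsPPCurvatureSingularity g U ℬ r

/-- `C^∞` extendibility: `C^r` extendibility for every `r`. -/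
def IsSmoothlyExtendible (g : CoordMetric) (U : Set (Fin 4 → ℝ)) (ℬ : Filter (Fin 4 → ℝ)) :
    Prop :=
  ∀ r : ℕ, IsExtendible g U ℬ r

/-! Flat FLRW spacetimes. -/

/-- The flat FLRW metric `-dt² + a(t)² (dx² + dy² + dz²)`, in Cartesian spatial coordinates. -/
def flrwMetric (a : ℝ → ℝ) : CoordMetric := fun x =>
  Matrix.diagonal ![-1, a (x 0) ^ 2, a (x 0) ^ 2, a (x 0) ^ 2]

/-- The FLRW spacetime region `I × ℝ³`, with `I` the range of the comoving time. -/
def flrwRegion (I : Set ℝ) : Set (Fin 4 → ℝ) := {x | x 0 ∈ I}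

/-- The past boundary `ℬ⁻`, approached as `t → -∞`. -/
def pastBoundary : Filter (Fin 4 → ℝ) := comap (fun x => x 0) atBot

/-- The Hubble parameter `H = ȧ / a`. -/
def hubble (a : ℝ → ℝ) (t : ℝ) : ℝ := deriv a t / a t

/-- The affine parameter `λ(t) = ∫_{-∞}^t a(t') dt'` of the radial null geodesics. -/
def affineParam (a : ℝ → ℝ) (t : ℝ) : ℝ := ∫ s in Iic t, a s

/-- The comoving time `t ∈ I` as a function of `λ`. -/
def timeOfAffineParam (a : ℝ → ℝ) (I : Set ℝ) : ℝ → ℝ :=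
  Function.invFunOn (affineParam a) I

/-- The quantity `Ḣ / a²` as a function of the affine parameter `λ`. -/
def hubbleRatio (a : ℝ → ℝ) (I : Set ℝ) (lam : ℝ) : ℝ :=
  deriv (hubble a) (timeOfAffineParam a I lam) / a (timeOfAffineParam a I lam) ^ 2

end FLRW

end

open Set Filter Topology MeasureTheory Asymptotics
open scoped ContDiff

noncomputable section

namespace FLRW

/-! Write θ = dλ = a dt and h = Ḣ/a². The curvature is H² times the constant-curvature tensor of g,
minus h times a product of g with θ ⊗ θ (`riemann_flrwMetric`). Since ∇g = 0, ∇θ = -aH g and d(f(λ))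
= f'(λ) θ, the tensors built from g and θ with coefficients depending on λ are stable under ∇
(`IsAffineTensor.exists_covDeriv`). As functions of λ, a' = H and H' = h a, so the coefficients of
∇ʳRiem are polynomials in a, H, h, …, h⁽ʳ⁾.

Extendibility (`IsRegularPast.isExtendible`): if h⁽ʳ⁾ converges at 0, so do the lower derivatives of
h, then H, hence all coefficients. In a parallel orthonormal tetrad E along a null geodesic γ, g has
constant components, and θ(E) has derivative -aH g(γ', E), where g(γ', E) is constant; so θ(E)
converges as well.

Singularity (`IsRegularPast.isPPCurvatureSingularity`): along a radial null ray with tangent k, θ(k)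
= 1, and a parallel unit vector e with g(k, e) = θ(e) = 0, Riem(k, e, k, e) = -h. Differentiating
along k differentiates this value in λ, because the terms coming from ∇θ contract k with k or e and
vanish. Thus -h⁽ʳ⁾ is a fixed linear combination of tetrad components, and these cannot all converge
if |h⁽ʳ⁾| → ∞.

Power laws: if Ḣ = a^q f(a) with q ≥ 2, then (a, H) solves a smooth autonomous system in λ and
converges at λ = 0, so every derivative of h converges. -/

/-! ### Connection and curvature of the flat FLRW metric. -/

/-- The Christoffel symbols of a flat FLRW metric as a bilinear map, in terms of `b = a ȧ` and the
Hubble parameter `H`. -/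
def flrwGamma (b H : ℝ) (v w : Fin 4 → ℝ) : Fin 4 → ℝ :=
  ![b * (v 1 * w 1 + v 2 * w 2 + v 3 * w 3), H * (v 0 * w 1 + v 1 * w 0),
    H * (v 0 * w 2 + v 2 * w 0), H * (v 0 * w 3 + v 3 * w 0)]

/-- The coordinate vector field `∂_i`. -/
def coordVec (i : Fin 4) : Fin 4 → ℝ := Pi.single i 1

lemma hasFDerivAt_comp_time {f : ℝ → ℝ} {f' : ℝ} {x : Fin 4 → ℝ} (hf : HasDerivAt f f' (x 0)) :
    HasFDerivAt (fun y : Fin 4 → ℝ => f (y 0))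
      (f' • (ContinuousLinearMap.proj 0 : (Fin 4 → ℝ) →L[ℝ] ℝ)) x :=
  hf.comp_hasFDerivAt x (hasFDerivAt_apply (0 : Fin 4) x)

lemma fderiv_comp_time {f : ℝ → ℝ} {f' : ℝ} {x : Fin 4 → ℝ} (hf : HasDerivAt f f' (x 0))
    (v : Fin 4 → ℝ) : fderiv ℝ (fun y : Fin 4 → ℝ => f (y 0)) x v = f' * v 0 := by
  rw [(hasFDerivAt_comp_time hf).fderiv]; simp

lemma pd_comp_time {f : ℝ → ℝ} {f' : ℝ} {x : Fin 4 → ℝ} (hf : HasDerivAt f f' (x 0))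
    (i : Fin 4) : pd i (fun y : Fin 4 → ℝ => f (y 0)) x = f' * coordVec i 0 :=
  fderiv_comp_time hf _

lemma flrwMetric_inv {a : ℝ → ℝ} {x : Fin 4 → ℝ} (ha : a (x 0) ≠ 0) :
    (flrwMetric a x)⁻¹ = Matrix.diagonal
      ![-1, (a (x 0) ^ 2)⁻¹, (a (x 0) ^ 2)⁻¹, (a (x 0) ^ 2)⁻¹] := by
  apply Matrix.inv_eq_right_inv
  rw [flrwMetric, Matrix.diagonal_mul_diagonal, ← Matrix.diagonal_one]
  congr 1
  funext i
  fin_cases i <;> simp [ha]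

lemma pd_flrwMetric {a : ℝ → ℝ} {a' : ℝ} {x : Fin 4 → ℝ} (ha : HasDerivAt a a' (x 0))
    (m i j : Fin 4) : pd m (fun y => flrwMetric a y i j) x =
      (if i = j then if i = 0 then 0 else 2 * a (x 0) * a' else 0) * coordVec m 0 := by
  by_cases hij : i = j
  · subst hij
    by_cases hi : i = 0
    · subst hi
      simp [flrwMetric, pd]
    · have h2 : HasDerivAt (fun t => a t ^ 2) (2 * a (x 0) * a') (x 0) := by
        simpa using ha.fun_pow 2
      have : (fun y => flrwMetric a y i i) = fun y => a (y 0) ^ 2 := by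
        funext y
        fin_cases i <;> simp [flrwMetric] at hi ⊢
      rw [this, pd_comp_time h2]
      simp [hi]
  · simp [flrwMetric, hij, pd]

lemma christoffel_flrwMetric {a : ℝ → ℝ} {a' : ℝ} {x : Fin 4 → ℝ}
    (ha : HasDerivAt a a' (x 0)) (ha0 : a (x 0) ≠ 0) (k i j : Fin 4) :
    christoffel (flrwMetric a) k i j x =
      flrwGamma (a (x 0) * a') (a' / a (x 0)) (coordVec i) (coordVec j) k := by
  simp only [christoffel, flrwMetric_inv ha0, pd_flrwMetric ha, Matrix.diagonal_apply, ite_mul,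
    zero_mul, Finset.sum_ite_eq, Finset.mem_univ, if_true]
  fin_cases k <;> fin_cases i <;> fin_cases j <;>
    simp [flrwGamma, coordVec] <;> field_simp

lemma pd_christoffel_flrwMetric {a : ℝ → ℝ} {I : Set ℝ} (hI : IsOpen I)
    (ha0 : ∀ t ∈ I, a t ≠ 0) (ha : ∀ t ∈ I, DifferentiableAt ℝ a t) {K : ℝ} {x : Fin 4 → ℝ}
    (hx : x 0 ∈ I) (hK : HasDerivAt (hubble a) K (x 0)) (m k i j : Fin 4) :
    pd m (christoffel (flrwMetric a) k i j) x =
      flrwGamma (a (x 0) ^ 2 * (2 * hubble a (x 0) ^ 2 + K)) K (coordVec i) (coordVec j) k *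
        coordVec m 0 := by
  have hU : ∀ᶠ y : Fin 4 → ℝ in 𝓝 x, y 0 ∈ I :=
    (continuous_apply 0).continuousAt.eventually_mem (hI.mem_nhds hx)
  have heq : christoffel (flrwMetric a) k i j =ᶠ[𝓝 x] fun y =>
      flrwGamma (a (y 0) ^ 2 * hubble a (y 0)) (hubble a (y 0)) (coordVec i) (coordVec j) k := by
    filter_upwards [hU] with y hy
    rw [christoffel_flrwMetric (ha _ hy).hasDerivAt (ha0 _ hy)]
    have := ha0 _ hy
    congr 1
    rw [hubble]; field_simp
  have hb : HasDerivAt (fun t => a t ^ 2 * hubble a t)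
      (a (x 0) ^ 2 * (2 * hubble a (x 0) ^ 2 + K)) (x 0) := by
    have h1 : HasDerivAt a (a (x 0) * hubble a (x 0)) (x 0) := by
      rw [hubble, mul_div_cancel₀ _ (ha0 _ hx)]
      exact (ha _ hx).hasDerivAt
    refine ((h1.fun_pow 2).fun_mul hK).congr_deriv ?_
    simp only [Nat.cast_ofNat]
    ring
  rw [pd, heq.fderiv_eq]
  refine pd_comp_time (f := fun t => flrwGamma (a t ^ 2 * hubble a t) (hubble a t) (coordVec i)
    (coordVec j) k) ?_ m
  fin_cases k
  · exact hb.mul_const _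
  all_goals exact hK.mul_const _

lemma metricProd_flrwMetric (a : ℝ → ℝ) (x v w : Fin 4 → ℝ) :
    metricProd (flrwMetric a) x v w =
      -(v 0 * w 0) + a (x 0) ^ 2 * (v 1 * w 1 + v 2 * w 2 + v 3 * w 3) := by
  simp [metricProd, flrwMetric, Fin.sum_univ_four, Matrix.diagonal_apply]
  ring

/-- The one-form `dλ = a dt`. -/
def affineForm (a : ℝ → ℝ) (x v : Fin 4 → ℝ) : ℝ := a (x 0) * v 0

-- Writing Ḣ as h a² absorbs all remaining powers of a into g and θ, so that H² and h are the only
-- coefficients. The identity is checked on all 256 index choices.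
set_option maxHeartbeats 4000000 in
lemma riemann_flrwMetric {a : ℝ → ℝ} {I : Set ℝ} (hI : IsOpen I)
    (ha0 : ∀ t ∈ I, a t ≠ 0) (ha : ∀ t ∈ I, DifferentiableAt ℝ a t) {h : ℝ} {x : Fin 4 → ℝ}
    (hx : x 0 ∈ I) (hK : HasDerivAt (hubble a) (h * a (x 0) ^ 2) (x 0)) (J : Fin 4 → Fin 4) :
    let g := fun i j => metricProd (flrwMetric a) x (coordVec (J i)) (coordVec (J j))
    let θ := fun i => affineForm a x (coordVec (J i))
    riemann (flrwMetric a) J x = hubble a (x 0) ^ 2 * (g 0 2 * g 1 3 - g 0 3 * g 1 2) -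
      h * (g 0 2 * (θ 1 * θ 3) - g 0 3 * (θ 1 * θ 2) + g 1 3 * (θ 0 * θ 2) -
        g 1 2 * (θ 0 * θ 3)) := by
  intro g θ
  have hchr : ∀ k i j, christoffel (flrwMetric a) k i j x =
      flrwGamma (a (x 0) ^ 2 * hubble a (x 0)) (hubble a (x 0)) (coordVec i) (coordVec j) k := by
    intro k i j
    rw [christoffel_flrwMetric (ha _ hx).hasDerivAt (ha0 _ hx)]
    have := ha0 _ hx
    congr 1
    rw [hubble]; field_simp
  simp only [g, θ, riemann, riemannUp, hchr, pd_christoffel_flrwMetric hI ha0 ha hx hK,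
    metricProd_flrwMetric, affineForm, flrwMetric, Matrix.diagonal_apply, ite_mul,
    zero_mul, Finset.sum_ite_eq, Finset.mem_univ, if_true]
  generalize hubble a (x 0) = H
  generalize a (x 0) = A
  generalize J 0 = l
  generalize J 1 = k
  generalize J 2 = i
  generalize J 3 = j
  fin_cases l <;> fin_cases k <;> fin_cases i <;> fin_cases j <;>
    simp [flrwGamma, coordVec, Fin.sum_univ_four] <;> ring

/-! ### Classes of coefficient functions of λ. -/

/-- `k` times differentiable functions on `D` which satisfy `P` together with their derivatives. -/
def DiffClass (P : (ℝ → ℝ) → Prop) (D : Set ℝ) : ℕ → (ℝ → ℝ) → Prop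
  | 0, f => P f
  | k + 1, f => P f ∧ ∃ f' : ℝ → ℝ, (∀ l ∈ D, HasDerivAt f (f' l) l) ∧ DiffClass P D k f'

namespace DiffClass

variable {P : (ℝ → ℝ) → Prop} {D : Set ℝ} {k : ℕ} {f g : ℝ → ℝ}

lemma of_succ (hf : DiffClass P D (k + 1) f) : DiffClass P D k f := by
  induction k generalizing f with
  | zero => exact hf.1
  | succ k ih =>
    obtain ⟨h, f', h1, h2⟩ := hf
    exact ⟨h, f', h1, ih h2⟩

lemma mono {j : ℕ} (hjk : j ≤ k) (hf : DiffClass P D k f) : DiffClass P D j f := by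
  induction hjk with
  | refl => exact hf
  | step _ ih => exact ih hf.of_succ

lemma add (hP : ∀ f g, P f → P g → P (fun l => f l + g l)) (hf : DiffClass P D k f)
    (hg : DiffClass P D k g) : DiffClass P D k fun l => f l + g l := by
  induction k generalizing f g with
  | zero => exact hP _ _ hf hg
  | succ k ih =>
    obtain ⟨h, f', h1, h2⟩ := hf
    obtain ⟨h', g', h1', h2'⟩ := hg
    exact ⟨hP _ _ h h', _, fun l hl => (h1 l hl).add (h1' l hl), ih h2 h2'⟩

lemma mul (hP : ∀ f g, P f → P g → P (fun l => f l + g l))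
    (hP' : ∀ f g, P f → P g → P (fun l => f l * g l)) (hf : DiffClass P D k f)
    (hg : DiffClass P D k g) : DiffClass P D k fun l => f l * g l := by
  induction k generalizing f g with
  | zero => exact hP' _ _ hf hg
  | succ k ih =>
    have hf1 := hf.of_succ
    have hg1 := hg.of_succ
    obtain ⟨h, f', h1, h2⟩ := hf
    obtain ⟨h', g', h1', h2'⟩ := hg
    exact ⟨hP' _ _ h h', _, fun l hl => (h1 l hl).mul (h1' l hl), add hP (ih h2 hg1) (ih hf1 h2')⟩

lemma neg (hP : ∀ f, P f → P (fun l => -f l)) (hf : DiffClass P D k f) :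
    DiffClass P D k fun l => -f l := by
  induction k generalizing f with
  | zero => exact hP _ hf
  | succ k ih =>
    obtain ⟨h, f', h1, h2⟩ := hf
    exact ⟨hP _ h, _, fun l hl => (h1 l hl).neg, ih h2⟩

lemma of_contDiffOn (hD : IsOpen D) (hf : ContDiffOn ℝ (k : ℕ) f D)
    (hP : ∀ j ≤ k, P (iteratedDeriv j f)) : DiffClass P D k f := by
  induction k generalizing f with
  | zero =>
    rw [← iteratedDeriv_zero (f := f)]
    exact hP 0 le_rfl
  | succ k ih =>
    have hf' : ContDiffOn ℝ ((k : WithTop ℕ∞) + 1) f D := by exact_mod_cast hf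
    rw [contDiffOn_succ_iff_deriv_of_isOpen hD] at hf'
    refine ⟨by simpa using hP 0 (Nat.zero_le _), deriv f, fun l hl =>
      (hf'.1.differentiableAt (hD.mem_nhds hl)).hasDerivAt, ih hf'.2.2 fun j hj => ?_⟩
    rw [← iteratedDeriv_succ']
    exact hP _ (Nat.succ_le_succ hj)

end DiffClass

/-! ### The tensors generated by g and dλ, and their stability under ∇. -/

/-- Covariant tensor fields generated, with coefficients `f(λ)` for `f` in the class `C`, by the
metric and `dλ`, as functions of the point and of the vectors in the slots `S`. The last argument is
the value of the tensor, as a function of `λ`, on vectors that are `e` in the slots marked by `ε` and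
`k` in all others, where `k` is null with `dλ(k) = 1` and `e` is a unit vector with
`g(k, e) = dλ(e) = 0`. -/
inductive IsAffineTensor (a L : ℝ → ℝ) (C : (ℝ → ℝ) → Prop) {n : ℕ} (ε : Fin n → Bool) :
    Finset (Fin n) → ((Fin 4 → ℝ) → (Fin n → Fin 4 → ℝ) → ℝ) → (ℝ → ℝ) → Prop
  | scalar {f : ℝ → ℝ} (hf : C f) : IsAffineTensor a L C ε ∅ (fun x _ => f (L (x 0))) f
  | add {S A B c d} (hA : IsAffineTensor a L C ε S A c) (hB : IsAffineTensor a L C ε S B d) :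
      IsAffineTensor a L C ε S (fun x v => A x v + B x v) (fun l => c l + d l)
  | smul {f : ℝ → ℝ} {S A c} (hf : C f) (hA : IsAffineTensor a L C ε S A c) :
      IsAffineTensor a L C ε S (fun x v => f (L (x 0)) * A x v) (fun l => f l * c l)
  | form {S A c} (m : Fin n) (hm : m ∉ S) (hA : IsAffineTensor a L C ε S A c) :
      IsAffineTensor a L C ε (insert m S) (fun x v => affineForm a x (v m) * A x v)
        (fun l => if ε m then 0 else c l)
  | metric {S A c} (m m' : Fin n) (hmm : m ≠ m') (hm : m ∉ S) (hm' : m' ∉ S)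
      (hA : IsAffineTensor a L C ε S A c) :
      IsAffineTensor a L C ε (insert m (insert m' S))
        (fun x v => metricProd (flrwMetric a) x (v m) (v m') * A x v)
        (fun l => if ε m ∧ ε m' then c l else 0)

lemma affineForm_add_smul (a : ℝ → ℝ) (x u w : Fin 4 → ℝ) (p q : ℝ) :
    affineForm a x (p • u + q • w) = p * affineForm a x u + q * affineForm a x w := by
  simp [affineForm]; ring

lemma metricProd_add_smul_left (g : CoordMetric) (x u w z : Fin 4 → ℝ) (p q : ℝ) :
    metricProd g x (p • u + q • w) z = p * metricProd g x u z + q * metricProd g x w z := by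
  simp only [metricProd, Finset.mul_sum, ← Finset.sum_add_distrib]
  refine Finset.sum_congr rfl fun i _ => Finset.sum_congr rfl fun j _ => ?_
  simp; ring

lemma metricProd_add_smul_right (g : CoordMetric) (x u w z : Fin 4 → ℝ) (p q : ℝ) :
    metricProd g x z (p • u + q • w) = p * metricProd g x z u + q * metricProd g x z w := by
  simp only [metricProd, Finset.mul_sum, ← Finset.sum_add_distrib]
  refine Finset.sum_congr rfl fun i _ => Finset.sum_congr rfl fun j _ => ?_
  simp; ring

/-- The coefficients of the Levi-Civita connection of the flat FLRW metric. -/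
def flrwConn (a : ℝ → ℝ) (x v w : Fin 4 → ℝ) : Fin 4 → ℝ :=
  flrwGamma (a (x 0) ^ 2 * hubble a (x 0)) (hubble a (x 0)) v w

lemma fderiv_affineForm {a : ℝ → ℝ} {x : Fin 4 → ℝ}
    (ha : HasDerivAt a (a (x 0) * hubble a (x 0)) (x 0)) (v w : Fin 4 → ℝ) :
    DifferentiableAt ℝ (fun y => affineForm a y w) x ∧
    fderiv ℝ (fun y => affineForm a y w) x v - affineForm a x (flrwConn a x v w) =
      -(a (x 0) * hubble a (x 0)) * metricProd (flrwMetric a) x v w := by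
  have h1 : HasDerivAt (fun t => a t * w 0) (a (x 0) * hubble a (x 0) * w 0) (x 0) :=
    ha.mul_const _
  refine ⟨(hasFDerivAt_comp_time h1).differentiableAt, ?_⟩
  have := fderiv_comp_time h1 v
  simp only [affineForm] at this ⊢
  rw [this, metricProd_flrwMetric]
  simp [flrwConn, flrwGamma]
  ring

lemma fderiv_metricProd {a : ℝ → ℝ} {x : Fin 4 → ℝ}
    (ha : HasDerivAt a (a (x 0) * hubble a (x 0)) (x 0)) (v u w : Fin 4 → ℝ) :
    DifferentiableAt ℝ (fun y => metricProd (flrwMetric a) y u w) x ∧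
    fderiv ℝ (fun y => metricProd (flrwMetric a) y u w) x v =
      metricProd (flrwMetric a) x (flrwConn a x v u) w +
      metricProd (flrwMetric a) x u (flrwConn a x v w) := by
  have h1 := ((ha.fun_pow 2).mul_const (u 1 * w 1 + u 2 * w 2 + u 3 * w 3)).const_add (-(u 0 * w 0))
  simp only [metricProd_flrwMetric]
  refine ⟨(hasFDerivAt_comp_time h1).differentiableAt, ?_⟩
  rw [fderiv_comp_time h1 v]
  simp [flrwConn, flrwGamma]
  ring

namespace IsAffineTensor

variable {a L : ℝ → ℝ} {C C' : (ℝ → ℝ) → Prop} {n : ℕ} {ε : Fin n → Bool} {S : Finset (Fin n)}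
  {A : (Fin 4 → ℝ) → (Fin n → Fin 4 → ℝ) → ℝ} {c : ℝ → ℝ}

/-- Makes room for slot 0, the direction of differentiation in the next covariant derivative. -/
lemma lift (hC : ∀ f, C f → C' f) (b : Bool) (hA : IsAffineTensor a L C ε S A c) :
    IsAffineTensor a L C' (Fin.cons b ε : Fin (n + 1) → Bool) (S.map (Fin.succEmb n))
      (fun x v => A x (Fin.tail v)) c := by
  induction hA with
  | scalar hf => exact scalar (hC _ hf)
  | add _ _ ihA ihB => exact ihA.add ihB
  | smul hf _ ih => exact ih.smul (hC _ hf)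
  | form m hm _ ih =>
    rw [Finset.map_insert]
    exact ih.form m.succ (by simpa using hm)
  | metric m m' hmm hm hm' _ ih =>
    rw [Finset.map_insert, Finset.map_insert]
    exact ih.metric m.succ m'.succ (by simpa using hmm) (by simpa using hm) (by simpa using hm')

lemma update_of_notMem (hA : IsAffineTensor a L C ε S A c) {j : Fin n} (hj : j ∉ S)
    (x : Fin 4 → ℝ) (v : Fin n → Fin 4 → ℝ) (w : Fin 4 → ℝ) :
    A x (Function.update v j w) = A x v := by
  induction hA with
  | scalar hf => rfl
  | add _ _ ihA ihB => simp only [ihA hj, ihB hj]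
  | smul hf _ ih => simp only [ih hj]
  | form m hm _ ih =>
    rw [Finset.mem_insert, not_or] at hj
    simp only [ih hj.2, Function.update_of_ne (Ne.symm hj.1)]
  | metric m m' hmm hm hm' _ ih =>
    simp only [Finset.mem_insert, not_or] at hj
    simp only [ih hj.2.2, Function.update_of_ne (Ne.symm hj.1),
      Function.update_of_ne (Ne.symm hj.2.1)]

lemma update_add_smul (hA : IsAffineTensor a L C ε S A c) {j : Fin n} (hj : j ∈ S)
    (x : Fin 4 → ℝ) (v : Fin n → Fin 4 → ℝ) (u w : Fin 4 → ℝ) (p q : ℝ) :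
    A x (Function.update v j (p • u + q • w)) =
      p * A x (Function.update v j u) + q * A x (Function.update v j w) := by
  induction hA with
  | scalar hf => simp at hj
  | add _ _ ihA ihB => simp only [ihA hj, ihB hj]; ring
  | smul hf _ ih => simp only [ih hj]; ring
  | form m hm hA ih =>
    by_cases h : j = m
    · subst h
      simp only [hA.update_of_notMem hm, Function.update_self, affineForm_add_smul]; ring
    · simp only [ih (Finset.mem_of_mem_insert_of_ne hj h), Function.update_of_ne (Ne.symm h)]; ring
  | metric m m' hmm hm hm' hA ih =>
    by_cases h : j = m
    · subst h
      simp only [hA.update_of_notMem hm, Function.update_self, Function.update_of_ne (Ne.symm hmm),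
        metricProd_add_smul_left]; ring
    by_cases h' : j = m'
    · subst h'
      simp only [hA.update_of_notMem hm', Function.update_self, Function.update_of_ne hmm,
        metricProd_add_smul_right]; ring
    simp only [Finset.mem_insert, h, h', false_or] at hj
    simp only [ih hj, Function.update_of_ne (Ne.symm h), Function.update_of_ne (Ne.symm h')]; ring

lemma exists_multilinearMap (hA : IsAffineTensor a L C ε Finset.univ A c) (x : Fin 4 → ℝ) :
    ∃ F : MultilinearMap ℝ (fun _ : Fin n => Fin 4 → ℝ) ℝ, ∀ v, A x v = F v :=
  ⟨{  toFun := A x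
      map_update_add' := fun v j u w => by
        have := hA.update_add_smul (Finset.mem_univ j) x v u w 1 1
        simp only [one_smul, one_mul] at this
        convert this
      map_update_smul' := fun v j p u => by
        have := hA.update_add_smul (Finset.mem_univ j) x v u 0 p 0
        simp only [zero_smul, add_zero, zero_mul] at this
        rw [smul_eq_mul]
        convert this }, fun _ => rfl⟩

lemma map_sum_smul (hA : IsAffineTensor a L C ε Finset.univ A c) (x : Fin 4 → ℝ)
    (M : Fin n → Fin 4 → ℝ) (w : Fin 4 → Fin 4 → ℝ) :
    A x (fun m => ∑ i, M m i • w i) =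
      ∑ J : Fin n → Fin 4, A x (fun m => w (J m)) * ∏ m, M m (J m) := by
  obtain ⟨F, hF⟩ := hA.exists_multilinearMap x
  simp only [hF]
  refine (F.map_sum (fun m i => M m i • w i)).trans (Finset.sum_congr rfl fun J _ => ?_)
  exact (F.map_smul_univ (fun m => M m (J m)) (fun m => w (J m))).trans (mul_comm _ _)

lemma update_sum_smul (hA : IsAffineTensor a L C ε Finset.univ A c) (x : Fin 4 → ℝ)
    (v : Fin n → Fin 4 → ℝ) (m : Fin n) (p : Fin 4 → ℝ) (w : Fin 4 → Fin 4 → ℝ) :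
    A x (Function.update v m (∑ i, p i • w i)) =
      ∑ i, p i * A x (Function.update v m (w i)) := by
  obtain ⟨F, hF⟩ := hA.exists_multilinearMap x
  simp only [hF, F.map_update_sum, F.map_update_smul, smul_eq_mul]

lemma eval_null (hA : IsAffineTensor a L C ε S A c) {x k e : Fin 4 → ℝ}
    (hk : affineForm a x k = 1) (he : affineForm a x e = 0)
    (hkk : metricProd (flrwMetric a) x k k = 0) (hke : metricProd (flrwMetric a) x k e = 0)
    (hek : metricProd (flrwMetric a) x e k = 0) (hee : metricProd (flrwMetric a) x e e = 1) :
    A x (fun m => if ε m then e else k) = c (L (x 0)) := by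
  induction hA with
  | scalar hf => rfl
  | add _ _ ihA ihB => simp only [ihA, ihB]
  | smul hf _ ih => simp only [ih]
  | form m hm _ ih => cases h : ε m <;> simp [ih, h, hk, he]
  | metric m m' hmm hm hm' _ ih =>
    cases h : ε m <;> cases h' : ε m' <;> simp [ih, h, h', hkk, hke, hek, hee]

lemma tendsto (hA : IsAffineTensor a L C ε S A c) {F : Filter ℝ} {γ : ℝ → Fin 4 → ℝ}
    {V : Fin n → ℝ → Fin 4 → ℝ}
    (hC : ∀ f, C f → ∃ l, Tendsto (fun s => f (L (γ s 0))) F (𝓝 l))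
    (hθ : ∀ m, ∃ l, Tendsto (fun s => affineForm a (γ s) (V m s)) F (𝓝 l))
    (hg : ∀ m m', ∃ l, Tendsto (fun s => metricProd (flrwMetric a) (γ s) (V m s) (V m' s)) F (𝓝 l)) :
    ∃ l, Tendsto (fun s => A (γ s) (fun m => V m s)) F (𝓝 l) := by
  induction hA with
  | scalar hf => exact hC _ hf
  | add _ _ ihA ihB =>
    obtain ⟨l, h⟩ := ihA
    obtain ⟨l', h'⟩ := ihB
    exact ⟨_, h.add h'⟩
  | smul hf _ ih =>
    obtain ⟨l, h⟩ := ih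
    obtain ⟨l', h'⟩ := hC _ hf
    exact ⟨_, h'.mul h⟩
  | form m hm _ ih =>
    obtain ⟨l, h⟩ := ih
    obtain ⟨l', h'⟩ := hθ m
    exact ⟨_, h'.mul h⟩
  | metric m m' hmm hm hm' _ ih =>
    obtain ⟨l, h⟩ := ih
    obtain ⟨l', h'⟩ := hg m m'
    exact ⟨_, h'.mul h⟩

/-- Leibniz rule with d(f(λ)) = f' θ, ∇θ = ρ g and ∇g = 0; one order of differentiability of the
coefficients is spent. The new slot is marked `false`, so it receives k: θ(k) = 1 turns d(f(λ)) into
f', while ρ g contributes nothing. Hence the distinguished value of ∇A is the λ-derivative of that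
of A. Differentiability of A is carried along to justify the product rule. -/
lemma exists_covDeriv {P : (ℝ → ℝ) → Prop} {I D : Set ℝ} {ρ : ℝ → ℝ} {k : ℕ}
    (ha : ∀ t ∈ I, HasDerivAt a (a t * hubble a t) t)
    (hL : ∀ t ∈ I, HasDerivAt L (a t) t) (hLD : MapsTo L I D)
    (hρ : ∀ t ∈ I, ρ (L t) = -(a t * hubble a t)) (hρk : DiffClass P D k ρ)
    (hA : IsAffineTensor a L (DiffClass P D (k + 1)) ε S A c) :
    ∃ A' c', IsAffineTensor a L (DiffClass P D k) (Fin.cons false ε : Fin (n + 1) → Bool)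
        (insert 0 (S.map (Fin.succEmb n))) A' c' ∧
      (∀ l ∈ D, HasDerivAt c (c' l) l) ∧
      (∀ x, x 0 ∈ I → ∀ v, DifferentiableAt ℝ (fun y => A y v) x) ∧
      ∀ x, x 0 ∈ I → ∀ v : Fin (n + 1) → Fin 4 → ℝ,
        A' x v = fderiv ℝ (fun y => A y (Fin.tail v)) x (v 0) -
          ∑ m ∈ S, A x (Function.update (Fin.tail v) m (flrwConn a x (v 0) (Fin.tail v m))) := by
  have h0 : ∀ S : Finset (Fin n), (0 : Fin (n + 1)) ∉ S.map (Fin.succEmb n) := fun S => by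
    simp [Fin.succ_ne_zero]
  have hmono : ∀ f, DiffClass P D (k + 1) f → DiffClass P D k f := fun f hf => hf.of_succ
  have hcoef : ∀ f f' : ℝ → ℝ, (∀ l ∈ D, HasDerivAt f (f' l) l) → ∀ x : Fin 4 → ℝ, x 0 ∈ I →
      HasDerivAt (fun t => f (L t)) (f' (L (x 0)) * a (x 0)) (x 0) := fun f f' hf x hx =>
    (hf _ (hLD hx)).comp (x 0) (hL _ hx)
  induction hA with
  | scalar hf =>
    obtain ⟨-, f', hf', hk⟩ := hf
    refine ⟨_, _, (scalar hk).form 0 (by simp), fun l hl => by simpa using hf' l hl,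
      fun x hx v => (hasFDerivAt_comp_time (hcoef _ _ hf' x hx)).differentiableAt,
      fun x hx v => ?_⟩
    simp only [fderiv_comp_time (hcoef _ _ hf' x hx), affineForm, Finset.sum_empty]
    ring
  | add _ _ ihA ihB =>
    obtain ⟨A', c', hA', hc', hd, hv⟩ := ihA
    obtain ⟨B', d', hB', hd', he, hw⟩ := ihB
    refine ⟨_, _, hA'.add hB', fun l hl => (hc' l hl).add (hd' l hl),
      fun x hx v => (hd x hx v).add (he x hx v), fun x hx v => ?_⟩
    rw [hv x hx, hw x hx, fderiv_fun_add (hd x hx _) (he x hx _), Finset.sum_add_distrib]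
    simp only [_root_.add_apply]
    ring
  | smul hf hA ih =>
    obtain ⟨A', c', hA', hc', hd, hv⟩ := ih
    have hf1 := hf.of_succ
    obtain ⟨-, f', hf', hk⟩ := hf
    have hF := fun x hx => (hasFDerivAt_comp_time (hcoef _ _ hf' x hx)).differentiableAt
    refine ⟨_, _, (((hA.lift hmono false).smul hk).form 0 (h0 _)).add (hA'.smul hf1),
      fun l hl => ?_, fun x hx v => (hF x hx).mul (hd x hx v), fun x hx v => ?_⟩
    · simpa using (hf' l hl).fun_mul (hc' l hl)
    · rw [hv x hx, fderiv_fun_mul (hF x hx) (hd x hx _), ← Finset.mul_sum]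
      simp only [_root_.add_apply, _root_.smul_apply, smul_eq_mul,
        fderiv_comp_time (hcoef _ _ hf' x hx), affineForm]
      ring
  | @form S A c m hm hA ih =>
    obtain ⟨A', c', hA', hc', hd, hv⟩ := ih
    -- `h1` is the term with ∇θ = ρ g, `h2` the term with ∇A. The former has distinguished value 0
    -- because slot 0 is not marked.
    have h1 := ((hA.lift hmono false).smul hρk).metric 0 m.succ (Fin.succ_ne_zero m).symm (h0 _)
      (by simpa using hm)
    have h2 := hA'.form m.succ (by simpa [Fin.succ_ne_zero] using hm)
    rw [Finset.insert_comm] at h2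
    rw [Finset.map_insert]
    refine ⟨_, _, h1.add h2, fun l hl => ?_,
      fun x hx v => (fderiv_affineForm (ha _ hx) 0 _).1.mul (hd x hx v), fun x hx v => ?_⟩
    · cases h : ε m
      · simpa [h] using hc' l hl
      · simpa [h] using hasDerivAt_const l (0 : ℝ)
    · have hθ := fderiv_affineForm (ha _ hx) (v 0) (Fin.tail v m)
      have hsum : ∑ j ∈ S, affineForm a x (Function.update (Fin.tail v) j
            (flrwConn a x (v 0) (Fin.tail v j)) m) *
            A x (Function.update (Fin.tail v) j (flrwConn a x (v 0) (Fin.tail v j))) =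
          affineForm a x (Fin.tail v m) *
            ∑ j ∈ S, A x (Function.update (Fin.tail v) j (flrwConn a x (v 0) (Fin.tail v j))) := by
        rw [Finset.mul_sum]
        refine Finset.sum_congr rfl fun j hj => ?_
        rw [Function.update_of_ne (ne_of_mem_of_not_mem hj hm).symm]
      rw [hv x hx, fderiv_fun_mul hθ.1 (hd x hx _), Finset.sum_insert hm]
      beta_reduce
      rw [hA.update_of_notMem hm, hsum, hρ _ hx]
      have h3 := hθ.2
      simp only [_root_.add_apply, _root_.smul_apply, smul_eq_mul,
        Function.update_self] at h3 ⊢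
      change metricProd (flrwMetric a) x (v 0) (Fin.tail v m) * _ +
        affineForm a x (Fin.tail v m) * _ = _
      linear_combination (-A x (Fin.tail v)) * h3
  | @metric S A c m m' hmm hm hm' hA ih =>
    obtain ⟨A', c', hA', hc', hd, hv⟩ := ih
    -- Only the term with ∇A survives, by metric compatibility.
    have h2 := hA'.metric m.succ m'.succ (by simpa using hmm)
      (by simpa [Fin.succ_ne_zero] using hm) (by simpa [Fin.succ_ne_zero] using hm')
    rw [Finset.insert_comm m'.succ, Finset.insert_comm m.succ] at h2
    rw [Finset.map_insert, Finset.map_insert]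
    refine ⟨_, _, h2, fun l hl => ?_,
      fun x hx v => (fderiv_metricProd (ha _ hx) 0 _ _).1.mul (hd x hx v), fun x hx v => ?_⟩
    · by_cases h : ε m = true ∧ ε m' = true
      · simpa [h] using hc' l hl
      · simpa [h] using hasDerivAt_const l (0 : ℝ)
    · have hg := fderiv_metricProd (ha _ hx) (v 0) (Fin.tail v m) (Fin.tail v m')
      have hm2 : m ∉ insert m' S := by simp [hmm, hm]
      have hsum : ∑ j ∈ S, metricProd (flrwMetric a) x
            (Function.update (Fin.tail v) j (flrwConn a x (v 0) (Fin.tail v j)) m)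
            (Function.update (Fin.tail v) j (flrwConn a x (v 0) (Fin.tail v j)) m') *
            A x (Function.update (Fin.tail v) j (flrwConn a x (v 0) (Fin.tail v j))) =
          metricProd (flrwMetric a) x (Fin.tail v m) (Fin.tail v m') *
            ∑ j ∈ S, A x (Function.update (Fin.tail v) j (flrwConn a x (v 0) (Fin.tail v j))) := by
        rw [Finset.mul_sum]
        refine Finset.sum_congr rfl fun j hj => ?_
        rw [Function.update_of_ne (ne_of_mem_of_not_mem hj hm).symm,
          Function.update_of_ne (ne_of_mem_of_not_mem hj hm').symm]
      rw [hv x hx, fderiv_fun_mul hg.1 (hd x hx _), Finset.sum_insert hm2, Finset.sum_insert hm']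
      beta_reduce
      rw [hA.update_of_notMem hm, hA.update_of_notMem hm', hsum]
      simp only [_root_.add_apply, _root_.smul_apply, smul_eq_mul,
        Function.update_self, Function.update_of_ne hmm, Function.update_of_ne hmm.symm, hg.2]
      change metricProd (flrwMetric a) x (Fin.tail v m) (Fin.tail v m') * _ = _
      ring

end IsAffineTensor

/-! ### The affine parameter as a coordinate, and the covariant derivatives of the curvature. -/

/-- The analytic facts about the affine parameter of a flat FLRW spacetime with finite past affine
length and vanishing scale factor at the past boundary. -/
structure IsRegularPast (a : ℝ → ℝ) (I : Set ℝ) : Prop where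
  isOpen : IsOpen I
  pos : ∀ t ∈ I, 0 < a t
  hasDerivAt_scale : ∀ t ∈ I, HasDerivAt a (a t * hubble a t) t
  hasDerivAt_hubble : ∀ t ∈ I, HasDerivAt (hubble a) (deriv (hubble a) t) t
  hasDerivAt_affineParam : ∀ t ∈ I, HasDerivAt (affineParam a) (a t) t
  isOpen_image : IsOpen (affineParam a '' I)
  Ioo_subset : ∃ b, 0 < b ∧ Ioo 0 b ⊆ affineParam a '' I
  time_mem : ∀ l ∈ affineParam a '' I, timeOfAffineParam a I l ∈ I
  time_affineParam : ∀ t ∈ I, timeOfAffineParam a I (affineParam a t) = t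
  affineParam_time : ∀ l ∈ affineParam a '' I, affineParam a (timeOfAffineParam a I l) = l
  hasDerivAt_time : ∀ l ∈ affineParam a '' I,
    HasDerivAt (timeOfAffineParam a I) (a (timeOfAffineParam a I l))⁻¹ l
  tendsto_affineParam : Tendsto (affineParam a) atBot (𝓝[>] 0)
  tendsto_time : Tendsto (timeOfAffineParam a I) (𝓝[>] 0) atBot
  tendsto_scale : Tendsto a atBot (𝓝 0)

/-- The scale factor as a function of the affine parameter. -/
def scaleAffine (a : ℝ → ℝ) (I : Set ℝ) (l : ℝ) : ℝ := a (timeOfAffineParam a I l)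

/-- The Hubble parameter as a function of the affine parameter. -/
def hubbleAffine (a : ℝ → ℝ) (I : Set ℝ) (l : ℝ) : ℝ := hubble a (timeOfAffineParam a I l)

/-- A function that is differentiable on a right neighbourhood of `0` and whose derivative has a
limit at `0` from the right has such a limit too. -/
lemma exists_tendsto_of_hasDerivAt {f f' : ℝ → ℝ} {b : ℝ} (hb : 0 < b)
    (hf : ∀ s ∈ Ioo 0 b, HasDerivAt f (f' s) s) (hf' : ∃ l, Tendsto f' (𝓝[>] 0) (𝓝 l)) :
    ∃ l, Tendsto f (𝓝[>] 0) (𝓝 l) := by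
  obtain ⟨l, hl⟩ := hf'
  have h1 : ∀ᶠ s in 𝓝[>] (0 : ℝ), ‖f' s‖₊ ≤ ‖l‖₊ + 1 :=
    (hl.nnnorm.eventually_lt_const (lt_add_one ‖l‖₊)).mono fun s hs => hs.le
  obtain ⟨c, hc, hcs⟩ := mem_nhdsGT_iff_exists_Ioo_subset.1 h1
  have hd : 0 < min b c := lt_min hb hc
  have hlip : LipschitzOnWith (‖l‖₊ + 1) f (Ioo 0 (min b c)) :=
    (convex_Ioo _ _).lipschitzOnWith_of_nnnorm_hasDerivWithin_le
      (fun x hx => (hf x ⟨hx.1, hx.2.trans_le (min_le_left _ _)⟩).hasDerivWithinAt)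
      fun x hx => hcs ⟨hx.1, hx.2.trans_le (min_le_right _ _)⟩
  -- A Lipschitz extension to the whole line is continuous at 0, and its value there is the limit.
  obtain ⟨g, hg, hfg⟩ := hlip.extend_real
  refine ⟨g 0, (hg.continuous.continuousAt.tendsto.mono_left nhdsWithin_le_nhds).congr' ?_⟩
  filter_upwards [Ioo_mem_nhdsGT hd] with s hs using (hfg hs).symm

lemma sum_smul_coordVec (v : Fin 4 → ℝ) : ∑ i, v i • coordVec i = v := by
  ext j
  simp [coordVec, Finset.sum_apply, Pi.single_apply]

namespace IsRegularPast

variable {a : ℝ → ℝ} {I : Set ℝ} (H : IsRegularPast a I)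
include H

lemma hubbleRatio_affineParam {t : ℝ} (ht : t ∈ I) :
    hubbleRatio a I (affineParam a t) = deriv (hubble a) t / a t ^ 2 := by
  rw [hubbleRatio, H.time_affineParam t ht]

/-- Dividing ȧ = aH by dλ/dt = a. Together with `hasDerivAt_hubbleAffine` this gives the system a' =
H, H' = h a, driven by h alone. -/
lemma hasDerivAt_scaleAffine {l : ℝ} (hl : l ∈ affineParam a '' I) :
    HasDerivAt (scaleAffine a I) (hubbleAffine a I l) l := by
  have ht := H.time_mem l hl
  have h0 := (H.pos _ ht).ne'
  refine ((H.hasDerivAt_scale _ ht).comp l (H.hasDerivAt_time l hl)).congr_deriv ?_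
  rw [hubbleAffine]; field_simp

lemma hasDerivAt_hubbleAffine {l : ℝ} (hl : l ∈ affineParam a '' I) :
    HasDerivAt (hubbleAffine a I) (hubbleRatio a I l * scaleAffine a I l) l := by
  have ht := H.time_mem l hl
  have h0 := (H.pos _ ht).ne'
  refine ((H.hasDerivAt_hubble _ ht).comp l (H.hasDerivAt_time l hl)).congr_deriv ?_
  rw [hubbleRatio, scaleAffine]; field_simp

lemma sum_christoffel {x : Fin 4 → ℝ} (hx : x 0 ∈ I) (k : Fin 4) (v w : Fin 4 → ℝ) :
    ∑ i, ∑ j, christoffel (flrwMetric a) k i j x * v i * w j = flrwConn a x v w k := by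
  have h0 := (H.pos _ hx).ne'
  have h1 : a (x 0) * (a (x 0) * hubble a (x 0)) = a (x 0) ^ 2 * hubble a (x 0) := by ring
  simp only [christoffel_flrwMetric (H.hasDerivAt_scale _ hx) h0, h1,
    mul_div_cancel_left₀ _ h0, flrwConn]
  fin_cases k <;> simp [Fin.sum_univ_four, flrwGamma, coordVec] <;> ring

lemma sum_christoffel_coordVec {x : Fin 4 → ℝ} (hx : x 0 ∈ I) (i j : Fin 4) :
    ∑ k, christoffel (flrwMetric a) k i j x • coordVec k =
      flrwConn a x (coordVec i) (coordVec j) := by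
  have h0 := (H.pos _ hx).ne'
  have h1 : a (x 0) * (a (x 0) * hubble a (x 0)) = a (x 0) ^ 2 * hubble a (x 0) := by ring
  simp only [christoffel_flrwMetric (H.hasDerivAt_scale _ hx) h0, h1,
    mul_div_cancel_left₀ _ h0, flrwConn]
  exact sum_smul_coordVec _

/-- Induction on `j` with `k` the number of derivatives still available, so each step invokes the
hypothesis at `k + 1`. -/
lemma isAffineTensor_iterCovDerivRiemann {P : (ℝ → ℝ) → Prop} (hP : ∀ f, P f → P fun l => -f l)
    {ρ σ : ℝ → ℝ} (hρ : ∀ t ∈ I, ρ (affineParam a t) = -(a t * hubble a t))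
    (hσ : ∀ t ∈ I, σ (affineParam a t) = hubble a t ^ 2) (j k : ℕ)
    (hρk : DiffClass P (affineParam a '' I) (j + k) ρ)
    (hσk : DiffClass P (affineParam a '' I) (j + k) σ)
    (hk : DiffClass P (affineParam a '' I) (j + k) (hubbleRatio a I)) :
    ∃ (ε : Fin (4 + j) → Bool) (A : _) (c : ℝ → ℝ),
      IsAffineTensor a (affineParam a) (DiffClass P (affineParam a '' I) k) ε Finset.univ A c ∧
      (∀ l ∈ affineParam a '' I, c l = -iteratedDeriv j (hubbleRatio a I) l) ∧
      ∀ x, x 0 ∈ I → ∀ J, iterCovDerivRiemann (flrwMetric a) j J x =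
        A x (fun m => coordVec (J m)) := by
  induction j generalizing k with
  | zero =>
    rw [zero_add] at hρk hσk hk
    -- Marks the component Riem(k, e, k, e). Of the six terms below only `t5`, -h g(e, e) θ(k) θ(k),
    -- is nonzero on it.
    let ε : Fin 4 → Bool := ![false, true, false, true]
    let L := affineParam a
    let C := DiffClass P (affineParam a '' I) k
    have t1 := ((IsAffineTensor.scalar (a := a) (L := L) (C := C) (ε := ε) hσk).metric 1 3
      (by decide) (by decide) (by decide)).metric 0 2 (by decide) (by decide) (by decide)
    have t2 := ((IsAffineTensor.scalar (a := a) (L := L) (C := C) (ε := ε) (hσk.neg hP)).metric 1 2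
      (by decide) (by decide) (by decide)).metric 0 3 (by decide) (by decide) (by decide)
    have t3 := (((IsAffineTensor.scalar (a := a) (L := L) (C := C) (ε := ε) (hk.neg hP)).form 3
      (by decide)).form 1 (by decide)).metric 0 2 (by decide) (by decide) (by decide)
    have t4 := (((IsAffineTensor.scalar (a := a) (L := L) (C := C) (ε := ε) hk).form 2
      (by decide)).form 1 (by decide)).metric 0 3 (by decide) (by decide) (by decide)
    have t5 := (((IsAffineTensor.scalar (a := a) (L := L) (C := C) (ε := ε) (hk.neg hP)).form 2
      (by decide)).form 0 (by decide)).metric 1 3 (by decide) (by decide) (by decide)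
    have t6 := (((IsAffineTensor.scalar (a := a) (L := L) (C := C) (ε := ε) hk).form 3
      (by decide)).form 0 (by decide)).metric 1 2 (by decide) (by decide) (by decide)
    rw [show insert 0 (insert 2 (insert 1 (insert 3 (∅ : Finset (Fin 4))))) = Finset.univ by decide]
      at t1
    rw [show insert 0 (insert 3 (insert 1 (insert 2 (∅ : Finset (Fin 4))))) = Finset.univ by decide]
      at t2
    rw [show insert 0 (insert 2 (insert 1 (insert 3 (∅ : Finset (Fin 4))))) = Finset.univ by decide]
      at t3
    rw [show insert 0 (insert 3 (insert 1 (insert 2 (∅ : Finset (Fin 4))))) = Finset.univ by decide]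
      at t4
    rw [show insert 1 (insert 3 (insert 0 (insert 2 (∅ : Finset (Fin 4))))) = Finset.univ by decide]
      at t5
    rw [show insert 1 (insert 2 (insert 0 (insert 3 (∅ : Finset (Fin 4))))) = Finset.univ by decide]
      at t6
    refine ⟨ε, _, _, (t1.add t2).add ((t3.add t4).add (t5.add t6)), fun l _ => by simp [ε],
      fun x hx J => ?_⟩
    have h0 := fun t ht => (H.pos t ht).ne'
    have hK : HasDerivAt (hubble a) (hubbleRatio a I (affineParam a (x 0)) * a (x 0) ^ 2) (x 0) := by
      rw [H.hubbleRatio_affineParam hx, div_mul_cancel₀ _ (pow_ne_zero 2 (h0 _ hx))]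
      exact H.hasDerivAt_hubble _ hx
    refine (riemann_flrwMetric H.isOpen h0 (fun t ht => (H.hasDerivAt_scale t ht).differentiableAt)
      hx hK J).trans ?_
    simp only [L, hσ _ hx]
    ring
  | succ j ih =>
    have hjk : j + 1 + k = j + (k + 1) := by omega
    rw [hjk] at hρk hσk hk
    obtain ⟨ε, A, c, hA, hc, hrep⟩ := ih (k + 1) hρk hσk hk
    have hρk' : DiffClass P (affineParam a '' I) k ρ :=
      hρk.mono (by omega)
    obtain ⟨A', c', hA', hc', -, hv⟩ := hA.exists_covDeriv H.hasDerivAt_scale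
      H.hasDerivAt_affineParam (mapsTo_image _ _) hρ hρk'
    have huniv : insert 0 (Finset.univ.map (Fin.succEmb (4 + j))) = Finset.univ := by
      rw [Fin.univ_succ, Finset.cons_eq_insert]; rfl
    rw [huniv] at hA'
    refine ⟨_, A', c', hA', fun l hl => ?_, fun x hx J => ?_⟩
    · rw [iteratedDeriv_succ]
      have heq : c =ᶠ[𝓝 l] fun l => -iteratedDeriv j (hubbleRatio a I) l := by
        filter_upwards [H.isOpen_image.mem_nhds hl] with y hy using hc y hy
      rw [← (hc' l hl).deriv, heq.deriv_eq, deriv.fun_neg]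
    · have hU : ∀ᶠ y : Fin 4 → ℝ in 𝓝 x, y 0 ∈ I :=
        (continuous_apply 0).continuousAt.eventually_mem (H.isOpen.mem_nhds hx)
      have heq : iterCovDerivRiemann (flrwMetric a) j (Fin.tail J) =ᶠ[𝓝 x]
          fun y => A y (fun m => coordVec (Fin.tail J m)) := by
        filter_upwards [hU] with y hy using hrep y hy _
      rw [hv x hx]
      refine congrArg₂ (· - ·) ?_ (Finset.sum_congr rfl fun m _ => ?_)
      · rw [pd, heq.fderiv_eq]; rfl
      · change _ = A x (Function.update (fun m => coordVec (Fin.tail J m)) m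
          (flrwConn a x (coordVec (J 0)) (coordVec (Fin.tail J m))))
        -- By multilinearity, inserting the vector Γ(∂ᵢ, ∂ⱼ) in one slot reproduces the Christoffel
        -- sum of the coordinate formula.
        rw [← H.sum_christoffel_coordVec hx, hA.update_sum_smul]
        refine Finset.sum_congr rfl fun i _ => ?_
        rw [hrep x hx]
        congr 2
        exact (Function.comp_update coordVec (Fin.tail J) m i)

end IsRegularPast

/-! ### Convergence of tetrad components: extendibility. -/

lemma frameComponent_eq {a L : ℝ → ℝ} {C : (ℝ → ℝ) → Prop} {n : ℕ} {ε : Fin n → Bool}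
    {A : (Fin 4 → ℝ) → (Fin n → Fin 4 → ℝ) → ℝ} {c : ℝ → ℝ}
    (hA : IsAffineTensor a L C ε Finset.univ A c) {T : CovTensor n} {x : Fin 4 → ℝ}
    (hT : ∀ J, T J x = A x (fun m => coordVec (J m))) (e : Fin 4 → Fin 4 → ℝ) (B : Fin n → Fin 4) :
    frameComponent T x e B = A x (fun m => e (B m)) := by
  have := hA.map_sum_smul x (fun m => e (B m)) coordVec
  simp only [sum_smul_coordVec] at this
  rw [this, frameComponent]
  simp only [hT]

/-- For parallel X the derivative of θ(X) is (∇θ)(γ', X), and ∇θ = -aH g. -/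
lemma hasDerivAt_affineForm_comp {a : ℝ → ℝ} {γ X : ℝ → Fin 4 → ℝ} {γ' X' : Fin 4 → ℝ} {s : ℝ}
    (ha : HasDerivAt a (a (γ s 0) * hubble a (γ s 0)) (γ s 0)) (hγ : HasDerivAt γ γ' s)
    (hX : HasDerivAt X X' s) (hX' : X' = -flrwConn a (γ s) γ' (X s)) :
    HasDerivAt (fun s => affineForm a (γ s) (X s))
      (-(a (γ s 0) * hubble a (γ s 0)) * metricProd (flrwMetric a) (γ s) γ' (X s)) s := by
  rw [hasDerivAt_pi] at hγ hX
  refine ((ha.comp s (hγ 0)).fun_mul (hX 0)).congr_deriv ?_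
  simp only [hX', metricProd_flrwMetric, flrwConn, flrwGamma, Pi.neg_apply, Function.comp_apply,
    Matrix.cons_val_zero]
  ring

lemma hasDerivAt_metricProd_comp {a : ℝ → ℝ} {γ X Y : ℝ → Fin 4 → ℝ} {γ' X' Y' : Fin 4 → ℝ}
    {s : ℝ} (ha : HasDerivAt a (a (γ s 0) * hubble a (γ s 0)) (γ s 0)) (hγ : HasDerivAt γ γ' s)
    (hX : HasDerivAt X X' s) (hX' : X' = -flrwConn a (γ s) γ' (X s))
    (hY : HasDerivAt Y Y' s) (hY' : Y' = -flrwConn a (γ s) γ' (Y s)) :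
    HasDerivAt (fun s => metricProd (flrwMetric a) (γ s) (X s) (Y s)) 0 s := by
  rw [hasDerivAt_pi] at hγ hX hY
  simp only [metricProd_flrwMetric]
  refine (((hX 0).fun_mul (hY 0)).fun_neg.fun_add (((ha.comp s (hγ 0)).fun_pow 2).fun_mul
    ((((hX 1).fun_mul (hY 1)).fun_add ((hX 2).fun_mul (hY 2))).fun_add
      ((hX 3).fun_mul (hY 3))))).congr_deriv ?_
  simp [hX', hY', flrwConn, flrwGamma]
  ring

/-- Existence of a finite limit at `0` from the right. -/
def HasRightLimit (f : ℝ → ℝ) : Prop := ∃ l, Tendsto f (𝓝[>] 0) (𝓝 l)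

namespace HasRightLimit

variable {f g : ℝ → ℝ}

lemma add (hf : HasRightLimit f) (hg : HasRightLimit g) : HasRightLimit fun l => f l + g l := by
  obtain ⟨l, hl⟩ := hf
  obtain ⟨m, hm⟩ := hg
  exact ⟨_, hl.add hm⟩

lemma mul (hf : HasRightLimit f) (hg : HasRightLimit g) : HasRightLimit fun l => f l * g l := by
  obtain ⟨l, hl⟩ := hf
  obtain ⟨m, hm⟩ := hg
  exact ⟨_, hl.mul hm⟩

lemma neg (hf : HasRightLimit f) : HasRightLimit fun l => -f l := by
  obtain ⟨l, hl⟩ := hf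
  exact ⟨_, hl.neg⟩

/-- A function whose derivative converges at 0⁺ converges there itself; apply this downwards from
order `r`. -/
lemma iteratedDeriv_of_le {D : Set ℝ} (hD : IsOpen D) {b : ℝ} (hb : 0 < b) (hbD : Ioo 0 b ⊆ D)
    {r : ℕ} (hf : ContDiffOn ℝ (r : ℕ) f D) (hr : HasRightLimit (iteratedDeriv r f)) :
    ∀ j ≤ r, HasRightLimit (iteratedDeriv j f) := by
  induction r generalizing f with
  | zero =>
    intro j hj
    rwa [Nat.le_zero.1 hj]
  | succ r ih =>
    have hf' : ContDiffOn ℝ ((r : WithTop ℕ∞) + 1) f D := by exact_mod_cast hf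
    rw [contDiffOn_succ_iff_deriv_of_isOpen hD] at hf'
    rw [iteratedDeriv_succ'] at hr
    have h1 := ih hf'.2.2 hr
    rintro (_ | j) hj
    · rw [iteratedDeriv_zero]
      exact exists_tendsto_of_hasDerivAt hb (fun s hs =>
        (hf'.1.differentiableAt (hD.mem_nhds (hbD hs))).hasDerivAt)
        (iteratedDeriv_zero (f := deriv f) ▸ h1 0 (Nat.zero_le _))
    · rw [iteratedDeriv_succ']
      exact h1 j (Nat.le_of_succ_le_succ hj)

end HasRightLimit

namespace IsRegularPast

variable {a : ℝ → ℝ} {I : Set ℝ} (H : IsRegularPast a I)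
include H

/-- Bootstrap through a' = H and H' = h a: class `k` for both a and H, with h in class `k`, gives
class `k + 1` for both. -/
lemma diffClass_scale_hubble {P : (ℝ → ℝ) → Prop}
    (hP : ∀ f g, P f → P g → P (fun l => f l + g l))
    (hP' : ∀ f g, P f → P g → P (fun l => f l * g l)) (h1 : P (scaleAffine a I))
    (h2 : P (hubbleAffine a I)) {k : ℕ}
    (hk : DiffClass P (affineParam a '' I) k (hubbleRatio a I)) :
    DiffClass P (affineParam a '' I) k (scaleAffine a I) ∧
      DiffClass P (affineParam a '' I) k (hubbleAffine a I) := by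
  induction k with
  | zero => exact ⟨h1, h2⟩
  | succ k ih =>
    obtain ⟨hs, hh⟩ := ih hk.of_succ
    exact ⟨⟨h1, _, fun l hl => H.hasDerivAt_scaleAffine hl, hh⟩,
      ⟨h2, _, fun l hl => H.hasDerivAt_hubbleAffine hl, hk.of_succ.mul hP hP' hs⟩⟩

/-- `P` is left open for two uses: existence of a right limit for extendibility, and the trivial
property for the singularity, where only the distinguished value matters. -/
lemma exists_isAffineTensor {P : (ℝ → ℝ) → Prop}
    (hP : ∀ f g, P f → P g → P (fun l => f l + g l))
    (hP' : ∀ f g, P f → P g → P (fun l => f l * g l)) (hP'' : ∀ f, P f → P fun l => -f l)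
    (h1 : P (scaleAffine a I)) (h2 : P (hubbleAffine a I)) {r : ℕ}
    (hr : DiffClass P (affineParam a '' I) r (hubbleRatio a I)) :
    ∃ (ε : Fin (4 + r) → Bool) (A : _) (c : ℝ → ℝ),
      IsAffineTensor a (affineParam a) P ε Finset.univ A c ∧
      (∀ l ∈ affineParam a '' I, c l = -iteratedDeriv r (hubbleRatio a I) l) ∧
      ∀ x, x 0 ∈ I → ∀ e B,
        frameComponent (iterCovDerivRiemann (flrwMetric a) r) x e B = A x (fun m => e (B m)) := by
  obtain ⟨hs, hh⟩ := H.diffClass_scale_hubble hP hP' h1 h2 hr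
  obtain ⟨ε, A, c, hA, hc, hrep⟩ := H.isAffineTensor_iterCovDerivRiemann hP''
    (ρ := fun l => -(scaleAffine a I l * hubbleAffine a I l))
    (σ := fun l => hubbleAffine a I l * hubbleAffine a I l)
    (fun t ht => by rw [scaleAffine, hubbleAffine, H.time_affineParam t ht])
    (fun t ht => by rw [hubbleAffine, H.time_affineParam t ht, sq]) r 0
    ((hs.mul hP hP' hh).neg hP'') (hh.mul hP hP' hh) hr
  exact ⟨ε, A, c, hA, hc, fun x hx e B => frameComponent_eq hA (hrep x hx) e B⟩

lemma hasRightLimit_scale_hubble (hlim : HasRightLimit (hubbleRatio a I)) :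
    HasRightLimit (scaleAffine a I) ∧ HasRightLimit (hubbleAffine a I) := by
  have h1 : HasRightLimit (scaleAffine a I) := ⟨0, H.tendsto_scale.comp H.tendsto_time⟩
  obtain ⟨b, hb, hbD⟩ := H.Ioo_subset
  exact ⟨h1, exists_tendsto_of_hasDerivAt hb
    (fun s hs => H.hasDerivAt_hubbleAffine (hbD hs)) (hlim.mul h1)⟩

theorem isExtendible {r : ℕ} (hr : ContDiffOn ℝ (r : ℕ) (hubbleRatio a I) (affineParam a '' I))
    (hlim : HasRightLimit (iteratedDeriv r (hubbleRatio a I))) :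
    IsExtendible (flrwMetric a) (flrwRegion I) pastBoundary r := by
  rintro ⟨b, γ, E, hb, hγ, hγb, hE, B, hB⟩
  apply hB
  obtain ⟨δ, hδ, hδD⟩ := H.Ioo_subset
  have hj := HasRightLimit.iteratedDeriv_of_le H.isOpen_image hδ hδD hr hlim
  have h0 : HasRightLimit (hubbleRatio a I) := by simpa using hj 0 (Nat.zero_le _)
  obtain ⟨hs, hh⟩ := H.hasRightLimit_scale_hubble h0
  obtain ⟨ε, A, c, hA, -, hrep⟩ := H.exists_isAffineTensor (P := HasRightLimit)
    (fun _ _ => .add) (fun _ _ => .mul) (fun _ => .neg) hs hh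
    (DiffClass.of_contDiffOn H.isOpen_image hr hj)
  have hL : Tendsto (fun s => affineParam a (γ s 0)) (𝓝[>] 0) (𝓝[>] 0) :=
    H.tendsto_affineParam.comp (tendsto_comap_iff.1 hγb)
  have hmem : ∀ s ∈ Ioo 0 b, γ s 0 ∈ I := fun s hs => hγ.mem s hs
  have hpar : ∀ X, IsParallelOn (flrwMetric a) γ X (Ioo 0 b) → ∀ s ∈ Ioo 0 b,
      HasDerivAt X (-flrwConn a (γ s) (deriv γ s) (X s)) s := fun X hX s hs => by
    refine (hX s hs).congr_deriv (funext fun k => ?_)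
    rw [H.sum_christoffel (hmem s hs)]
    rfl
  have hC : ∀ f, HasRightLimit f →
      ∃ l, Tendsto (fun s => f (affineParam a (γ s 0))) (𝓝[>] 0) (𝓝 l) := fun f ⟨l, hl⟩ =>
    ⟨l, hl.comp hL⟩
  have hev : ∀ᶠ s in 𝓝[>] (0 : ℝ), s ∈ Ioo 0 b := Ioo_mem_nhdsGT hb
  have hθ : ∀ M, ∃ l, Tendsto (fun s => affineForm a (γ s) (E M s)) (𝓝[>] 0) (𝓝 l) := by
    intro M
    refine exists_tendsto_of_hasDerivAt hb (fun s hs => hasDerivAt_affineForm_comp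
      (H.hasDerivAt_scale _ (hmem s hs)) (hγ.differentiable s hs).hasDerivAt
      (hpar _ (hE.parallel M) s hs) rfl) ?_
    obtain ⟨l, hl⟩ := hC _ (hs.mul hh).neg
    -- Both γ' and E are parallel, so their product is constant; b / 2 is just a reference point.
    have hconst : ∀ s ∈ Ioo 0 b, metricProd (flrwMetric a) (γ s) (deriv γ s) (E M s) =
        metricProd (flrwMetric a) (γ (b / 2)) (deriv γ (b / 2)) (E M (b / 2)) := by
      have hd : ∀ s ∈ Ioo 0 b,
          HasDerivAt (fun s => metricProd (flrwMetric a) (γ s) (deriv γ s) (E M s)) 0 s :=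
        fun s hs => hasDerivAt_metricProd_comp
          (H.hasDerivAt_scale _ (hmem s hs)) (hγ.differentiable s hs).hasDerivAt
          (hpar _ hγ.geodesic s hs) rfl (hpar _ (hE.parallel M) s hs) rfl
      intro s hs
      exact isOpen_Ioo.is_const_of_deriv_eq_zero isPreconnected_Ioo
        (fun s hs => (hd s hs).differentiableAt.differentiableWithinAt)
        (fun s hs => (hd s hs).deriv) hs ⟨by linarith, by linarith⟩
    refine ⟨_, (hl.mul_const (metricProd (flrwMetric a) (γ (b / 2)) (deriv γ (b / 2))
      (E M (b / 2)))).congr' ?_⟩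
    filter_upwards [hev] with s hs
    rw [hconst s hs, scaleAffine, hubbleAffine, H.time_affineParam _ (hmem s hs)]
  have hg : ∀ M N, ∃ l,
      Tendsto (fun s => metricProd (flrwMetric a) (γ s) (E M s) (E N s)) (𝓝[>] 0) (𝓝 l) :=
    fun M N => ⟨minkowski M N, tendsto_const_nhds.congr' (by
      filter_upwards [hev] with s hs using (hE.orthonormal s hs M N).symm)⟩
  obtain ⟨l, hl⟩ := hA.tendsto (V := fun m => E (B m)) hC (fun m => hθ _) (fun m m' => hg _ _)
  refine ⟨l, hl.congr' ?_⟩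
  filter_upwards [hev] with s hs
  rw [hrep _ (hmem s hs)]

end IsRegularPast

/-! ### An explicit null ray with parallel tetrad: the singularity. -/

/-- Parallel vector fields along the radial null geodesics, in terms of the affine parameter. They
have constant coefficients in the frame that consists of the tangent vector `k`, of a null vector and
of two unit vectors orthogonal to both. -/
def nullTransport (a : ℝ → ℝ) (I : Set ℝ) (u v w z s : ℝ) : Fin 4 → ℝ :=
  ![u * (scaleAffine a I s)⁻¹ + v * scaleAffine a I s, u * (scaleAffine a I s)⁻¹ ^ 2 - v,
    w * (scaleAffine a I s)⁻¹, z * (scaleAffine a I s)⁻¹]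

/-- A radial null geodesic, parametrized by `λ`. -/
def nullRay (a : ℝ → ℝ) (I : Set ℝ) (b s : ℝ) : Fin 4 → ℝ :=
  -- The integral starts at an interior point because a⁻² blows up at 0. The behaviour of x does not
  -- matter, as the past boundary only constrains t.
  ![timeOfAffineParam a I s, ∫ l in (b / 2)..s, (scaleAffine a I l)⁻¹ ^ 2, 0, 0]

/-- The coefficients of a parallel orthonormal tetrad with respect to the null frame. -/
def nullTetrad (a : ℝ → ℝ) (I : Set ℝ) : Fin 4 → ℝ → Fin 4 → ℝ :=
  ![nullTransport a I (1 / 2) (1 / 2) 0 0, nullTransport a I (1 / 2) (-1 / 2) 0 0,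
    nullTransport a I 0 0 1 0, nullTransport a I 0 0 0 1]

namespace IsRegularPast

variable {a : ℝ → ℝ} {I : Set ℝ} (H : IsRegularPast a I)
include H

lemma scaleAffine_pos {s : ℝ} (hs : s ∈ affineParam a '' I) : 0 < scaleAffine a I s :=
  H.pos _ (H.time_mem s hs)

lemma hasDerivAt_inv_scaleAffine {s : ℝ} (hs : s ∈ affineParam a '' I) :
    HasDerivAt (fun s => (scaleAffine a I s)⁻¹)
      (-hubbleAffine a I s * (scaleAffine a I s)⁻¹ ^ 2) s := by
  refine ((H.hasDerivAt_scaleAffine hs).fun_inv (H.scaleAffine_pos hs).ne').congr_deriv ?_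
  rw [inv_pow, div_eq_mul_inv]

lemma hasDerivAt_nullRay {b s : ℝ} (hb : Ioo 0 b ⊆ affineParam a '' I) (hs : s ∈ Ioo 0 b) :
    HasDerivAt (nullRay a I b) (nullTransport a I 1 0 0 0 s) s := by
  have hc : ContinuousOn (fun l => (scaleAffine a I l)⁻¹ ^ 2) (Ioo 0 b) := fun l hl =>
    ((H.hasDerivAt_inv_scaleAffine (hb hl)).continuousAt.pow 2).continuousWithinAt
  have hb2 : b / 2 ∈ Ioo 0 b := ⟨by linarith [hs.1, hs.2], by linarith [hs.1, hs.2]⟩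
  have hsub : uIcc (b / 2) s ⊆ Ioo 0 b := OrdConnected.uIcc_subset inferInstance hb2 hs
  rw [hasDerivAt_pi]
  intro i
  fin_cases i
  · simpa [nullRay, nullTransport, scaleAffine] using H.hasDerivAt_time s (hb hs)
  · have := intervalIntegral.integral_hasDerivAt_right
      ((hc.mono hsub).intervalIntegrable)
      (hc.stronglyMeasurableAtFilter isOpen_Ioo s hs) (hc.continuousAt (isOpen_Ioo.mem_nhds hs))
    simpa [nullRay, nullTransport] using this
  · simpa [nullRay, nullTransport] using hasDerivAt_const s (0 : ℝ)
  · simpa [nullRay, nullTransport] using hasDerivAt_const s (0 : ℝ)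

lemma hasDerivAt_nullTransport (b u v w z : ℝ) {s : ℝ} (hs : s ∈ affineParam a '' I) :
    HasDerivAt (nullTransport a I u v w z)
      (-flrwConn a (nullRay a I b s) (nullTransport a I 1 0 0 0 s)
        (nullTransport a I u v w z s)) s := by
  have h1 := H.hasDerivAt_scaleAffine hs
  have h2 := H.hasDerivAt_inv_scaleAffine hs
  have h0 := (H.scaleAffine_pos hs).ne'
  have ha : a (timeOfAffineParam a I s) = scaleAffine a I s := rfl
  have hH : hubble a (timeOfAffineParam a I s) = hubbleAffine a I s := rfl
  rw [hasDerivAt_pi]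
  intro i
  fin_cases i
  · refine ((h2.const_mul u).fun_add (h1.const_mul v)).congr_deriv ?_
    simp [flrwConn, flrwGamma, nullRay, nullTransport, ha, hH]
    field_simp
    ring
  · refine (((h2.fun_pow 2).const_mul u).sub_const v).congr_deriv ?_
    simp [flrwConn, flrwGamma, nullRay, nullTransport, ha, hH]
    field_simp
    ring
  · refine (h2.const_mul w).congr_deriv ?_
    simp [flrwConn, flrwGamma, nullRay, nullTransport, ha, hH]
    field_simp
  · refine (h2.const_mul z).congr_deriv ?_
    simp [flrwConn, flrwGamma, nullRay, nullTransport, ha, hH]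
    field_simp

lemma metricProd_nullTransport (b u v w z u' v' w' z' : ℝ) {s : ℝ} (hs : s ∈ affineParam a '' I) :
    metricProd (flrwMetric a) (nullRay a I b s) (nullTransport a I u v w z s)
      (nullTransport a I u' v' w' z' s) = -2 * (u * v' + v * u') + w * w' + z * z' := by
  have h0 := (H.scaleAffine_pos hs).ne'
  have ha : a (timeOfAffineParam a I s) = scaleAffine a I s := rfl
  rw [metricProd_flrwMetric]
  simp only [nullRay, nullTransport, Matrix.cons_val, ha]
  field_simp
  ring

lemma affineForm_nullTransport (b u v w z : ℝ) {s : ℝ} (hs : s ∈ affineParam a '' I) :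
    affineForm a (nullRay a I b s) (nullTransport a I u v w z s) =
      u + v * scaleAffine a I s ^ 2 := by
  have h0 := (H.scaleAffine_pos hs).ne'
  have ha : a (timeOfAffineParam a I s) = scaleAffine a I s := rfl
  simp only [affineForm, nullRay, nullTransport, Matrix.cons_val, ha]
  field_simp

lemma isParallelOn_nullTransport {b : ℝ} (hb : Ioo 0 b ⊆ affineParam a '' I) (u v w z : ℝ) :
    IsParallelOn (flrwMetric a) (nullRay a I b) (nullTransport a I u v w z) (Ioo 0 b) := by
  intro s hs
  refine (H.hasDerivAt_nullTransport b u v w z (hb hs)).congr_deriv (funext fun k => ?_)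
  have hm : nullRay a I b s 0 ∈ I := H.time_mem s (hb hs)
  rw [H.sum_christoffel hm, (H.hasDerivAt_nullRay hb hs).deriv]
  rfl

lemma isNullGeodesicOn_nullRay {b : ℝ} (hb : Ioo 0 b ⊆ affineParam a '' I) :
    IsNullGeodesicOn (flrwMetric a) (flrwRegion I) (nullRay a I b) (Ioo 0 b) where
  mem s hs := H.time_mem s (hb hs)
  differentiable s hs := (H.hasDerivAt_nullRay hb hs).differentiableAt
  geodesic s hs := by
    have heq : deriv (nullRay a I b) =ᶠ[𝓝 s] nullTransport a I 1 0 0 0 := by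
      filter_upwards [isOpen_Ioo.mem_nhds hs] with y hy using (H.hasDerivAt_nullRay hb hy).deriv
    have := H.isParallelOn_nullTransport hb 1 0 0 0 s hs
    rw [← heq.eq_of_nhds] at this
    exact this.congr_of_eventuallyEq heq
  null s hs := by
    rw [(H.hasDerivAt_nullRay hb hs).deriv, H.metricProd_nullTransport b _ _ _ _ _ _ _ _ (hb hs)]
    norm_num

lemma isPPTetradOn_nullTetrad {b : ℝ} (hb : Ioo 0 b ⊆ affineParam a '' I) :
    IsPPTetradOn (flrwMetric a) (nullRay a I b) (nullTetrad a I) (Ioo 0 b) where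
  parallel M := by fin_cases M <;> exact H.isParallelOn_nullTransport hb _ _ _ _
  orthonormal s hs M N := by
    have h := fun u v w z u' v' w' z' =>
      H.metricProd_nullTransport b u v w z u' v' w' z' (hb hs)
    fin_cases M <;> fin_cases N <;> simp [nullTetrad, h, minkowski] <;> norm_num

theorem isPPCurvatureSingularity {r : ℕ}
    (hr : ContDiffOn ℝ (r : ℕ) (hubbleRatio a I) (affineParam a '' I))
    (hlim : Tendsto (fun l => |iteratedDeriv r (hubbleRatio a I) l|) (𝓝[>] 0) atTop) :
    IsPPCurvatureSingularity (flrwMetric a) (flrwRegion I) pastBoundary r := by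
  obtain ⟨b, hb, hbD⟩ := H.Ioo_subset
  refine ⟨b, nullRay a I b, nullTetrad a I, hb, H.isNullGeodesicOn_nullRay hbD,
    tendsto_comap_iff.2 H.tendsto_time, H.isPPTetradOn_nullTetrad hbD, ?_⟩
  by_contra! hall
  obtain ⟨ε, A, c, hA, hc, hrep⟩ := H.exists_isAffineTensor (P := fun _ => True) (by simp) (by simp)
    (by simp) trivial trivial (DiffClass.of_contDiffOn H.isOpen_image hr (by simp))
  choose ℓ hℓ using hall
  -- Coefficients in the tetrad of e = E₂ and k = E₀ + E₁.
  let M : Fin (4 + r) → Fin 4 → ℝ := fun m i => if ε m then ![0, 0, 1, 0] i else ![1, 1, 0, 0] i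
  have hlim' : Tendsto (fun s => |∑ J : Fin (4 + r) → Fin 4,
      frameComponent (iterCovDerivRiemann (flrwMetric a) r) (nullRay a I b s)
        (fun N => nullTetrad a I N s) J * ∏ m, M m (J m)|) (𝓝[>] 0)
      (𝓝 |∑ J : Fin (4 + r) → Fin 4, ℓ J * ∏ m, M m (J m)|) :=
    (tendsto_finsetSum _ fun J _ => (hℓ J).mul_const _).abs
  refine not_tendsto_nhds_of_tendsto_atTop hlim _ (hlim'.congr' ?_)
  filter_upwards [Ioo_mem_nhdsGT hb] with s hs
  have hsD := hbD hs
  have hm : nullRay a I b s 0 ∈ I := H.time_mem s hsD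
  have hθ := fun u v w z => H.affineForm_nullTransport b u v w z hsD
  have hg := fun u v w z u' v' w' z' => H.metricProd_nullTransport b u v w z u' v' w' z' hsD
  have h1 := hA.eval_null (x := nullRay a I b s) (k := nullTransport a I 1 0 0 0 s)
    (e := nullTransport a I 0 0 1 0 s) (by simp [hθ]) (by simp [hθ]) (by simp [hg]) (by simp [hg])
    (by simp [hg]) (by simp [hg])
  have h2 : (fun m => if ε m then nullTransport a I 0 0 1 0 s else nullTransport a I 1 0 0 0 s) =
      fun m => ∑ i, M m i • nullTetrad a I i s := by
    funext m i
    cases h : ε m <;> fin_cases i <;>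
      simp [M, h, Fin.sum_univ_four, nullTetrad, nullTransport] <;> ring
  have h3 : affineParam a (nullRay a I b s 0) = s := H.affineParam_time s hsD
  rw [h2, hA.map_sum_smul, h3, hc s hsD] at h1
  simp only [hrep _ hm]
  rw [h1, abs_neg]

end IsRegularPast

/-! ### The affine parameter of a past asymptotically de Sitter scale factor. -/

/-- The de Sitter asymptotics serve to make a integrable at -∞ and to give a → 0. The rest follows
from dλ/dt = a > 0: λ is strictly increasing from 0⁺ and has a differentiable inverse. -/
lemma isRegularPast {I : Set ℝ} (hI_open : IsOpen I) (hI_lower : IsLowerSet I) (hI_ne : I.Nonempty)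
    {a : ℝ → ℝ} (ha_pos : ∀ t ∈ I, 0 < a t) {abar HL : ℝ} (hHL : 0 < HL)
    (hdS : a ~[atBot] fun t => abar * Real.exp (HL * t)) (ha : ContDiffOn ℝ 2 a I) :
    IsRegularPast a I := by
  have hIcc : ∀ t ∈ I, Iic t ⊆ I := fun t ht s hs => hI_lower hs ht
  have hnhds := fun t (ht : t ∈ I) => hI_open.mem_nhds ht
  have ha1 : ∀ t ∈ I, HasDerivAt a (deriv a t) t := fun t ht =>
    ((ha.differentiableOn (by norm_num)).differentiableAt (hnhds t ht)).hasDerivAt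
  have ha2 : ∀ t ∈ I, HasDerivAt (deriv a) (deriv (deriv a) t) t := fun t ht =>
    (((ha.deriv_of_isOpen (m := 1) hI_open (by norm_num)).differentiableOn
      (by norm_num)).differentiableAt (hnhds t ht)).hasDerivAt
  have hbot : ∀ᶠ t in atBot, t ∈ I := by
    obtain ⟨t, ht⟩ := hI_ne
    exact (eventually_le_atBot t).mono fun s hs => hIcc t ht hs
  have hint : ∀ t ∈ I, IntegrableOn a (Iic t) := fun t ht => by
    refine LocallyIntegrableOn.integrableOn_of_isBigO_atBot
      ((ha.continuousOn.mono (hIcc t ht)).locallyIntegrableOn measurableSet_Iic) hdS.isBigO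
      ⟨Iic t, Iic_mem_atBot t, (integrableOn_exp_mul_Iic hHL t).const_mul abar⟩
  have hexp : Tendsto (fun t => abar * Real.exp (HL * t)) atBot (𝓝 0) := by
    simpa using (Real.tendsto_exp_atBot.comp (tendsto_id.const_mul_atBot hHL)).const_mul abar
  have hderiv : ∀ t ∈ I, HasDerivAt (affineParam a) (a t) t := fun t ht => by
    have h1 : affineParam a =ᶠ[𝓝 t] fun s => affineParam a t + ∫ u in t..s, a u := by
      filter_upwards [hnhds t ht] with s hs
      rw [← intervalIntegral.integral_Iic_sub_Iic (hint t ht) (hint s hs)]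
      simp [affineParam]
    refine HasDerivAt.congr_of_eventuallyEq (HasDerivAt.const_add _ ?_) h1
    exact intervalIntegral.integral_hasDerivAt_right (by simp)
      (ha.continuousOn.stronglyMeasurableAtFilter hI_open t ht)
      (ha.continuousOn.continuousAt (hnhds t ht))
  have hcont : ContinuousOn (affineParam a) I := fun t ht =>
    (hderiv t ht).continuousAt.continuousWithinAt
  have hmono : StrictMonoOn (affineParam a) I := by
    refine strictMonoOn_of_deriv_pos hI_lower.ordConnected.convex hcont fun t ht => ?_
    rw [(hderiv t (interior_subset ht)).deriv]
    exact ha_pos t (interior_subset ht)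
  have hpos : ∀ t ∈ I, 0 < affineParam a t := fun t ht => by
    have ht1 : t - 1 ∈ I := hIcc t ht (sub_le_self t zero_le_one)
    refine lt_of_le_of_lt ?_ (hmono ht1 ht (sub_one_lt t))
    exact setIntegral_nonneg measurableSet_Iic fun s hs => (ha_pos s (hIcc _ ht1 hs)).le
  have htend : Tendsto (affineParam a) atBot (𝓝 0) := by
    obtain ⟨t, ht⟩ := hI_ne
    have h1 := (intervalIntegral_tendsto_integral_Iic t (hint t ht) tendsto_id).const_sub
      (affineParam a t)
    rw [affineParam, sub_self] at h1
    refine h1.congr' ?_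
    filter_upwards [hbot] with s hs
    rw [id, ← intervalIntegral.integral_Iic_sub_Iic (hint s hs) (hint t ht)]
    simp [affineParam]
  have hleft : ∀ t ∈ I, timeOfAffineParam a I (affineParam a t) = t := fun t ht =>
    hmono.injOn.leftInvOn_invFunOn ht
  have hstrict : ∀ t ∈ I, HasStrictDerivAt (affineParam a) (a t) t := fun t ht =>
    hasStrictDerivAt_of_hasDerivAt_of_continuousAt
      (Eventually.mono (hnhds t ht) hderiv) (ha.continuousOn.continuousAt (hnhds t ht))
  have himage : ∀ t ∈ I, Ioc 0 (affineParam a t) ⊆ affineParam a '' I := fun t ht l hl => by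
    -- Since λ → 0 at -∞, some earlier time has a smaller λ, and the intermediate value theorem
    -- applies.
    obtain ⟨s, hs, hst⟩ := ((htend.eventually_lt_const hl.1).and (eventually_le_atBot t)).exists
    obtain ⟨u, hu, rfl⟩ := intermediate_value_Icc hst
      (hcont.mono (Icc_subset_Iic_self.trans (hIcc t ht))) ⟨hs.le, hl.2⟩
    exact mem_image_of_mem _ (hIcc t ht hu.2)
  have htime : ∀ l ∈ affineParam a '' I, timeOfAffineParam a I l ∈ I := by
    rintro _ ⟨t, ht, rfl⟩
    rwa [hleft t ht]
  have hright : ∀ l ∈ affineParam a '' I, affineParam a (timeOfAffineParam a I l) = l := by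
    rintro _ ⟨t, ht, rfl⟩
    rw [hleft t ht]
  refine ⟨hI_open, ha_pos, fun t ht => ?_, fun t ht => ?_, hderiv, ?_, ?_, htime, hleft, hright,
    ?_, ?_, ?_, ?_⟩
  · rw [hubble, mul_div_cancel₀ _ (ha_pos t ht).ne']
    exact ha1 t ht
  · exact ((ha2 t ht).differentiableAt.div (ha1 t ht).differentiableAt
      (ha_pos t ht).ne').hasDerivAt
  · rw [isOpen_iff_mem_nhds]
    rintro _ ⟨t, ht, rfl⟩
    rw [← (hstrict t ht).map_nhds_eq (ha_pos t ht).ne']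
    exact image_mem_map (hnhds t ht)
  · obtain ⟨t, ht⟩ := hI_ne
    exact ⟨_, hpos t ht, Ioo_subset_Ioc_self.trans (himage t ht)⟩
  · rintro _ ⟨t, ht, rfl⟩
    rw [hleft t ht]
    exact ((hstrict t ht).to_local_left_inverse (ha_pos t ht).ne'
      (Eventually.mono (hnhds t ht) hleft)).hasDerivAt
  · exact tendsto_nhdsWithin_iff.2 ⟨htend, hbot.mono hpos⟩
  · refine tendsto_atBot.2 fun M => ?_
    obtain ⟨t, ht, htM⟩ := (hbot.and (eventually_le_atBot M)).exists
    filter_upwards [Ioo_mem_nhdsGT (hpos t ht)] with l hl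
    have hlD := himage t ht ⟨hl.1, hl.2.le⟩
    refine le_trans (le_of_lt ?_) htM
    rw [← hmono.lt_iff_lt (htime l hlD) ht, hright l hlD]
    exact hl.2
  · exact hdS.symm.tendsto_nhds hexp

/-! ### Regularity of Ḣ/a² in λ, and power laws. -/

namespace IsRegularPast

variable {a : ℝ → ℝ} {I : Set ℝ} (H : IsRegularPast a I)
include H

/-- The λ-derivative of G(t(λ)) is (G'/a)(t(λ)), of the same form with one order less. The factor
1/a first enters after one differentiation, whence `k ≤ n + 1`. -/
lemma contDiffOn_comp_time {n : ℕ} (ha : ContDiffOn ℝ (n : ℕ) a I) {k : ℕ} (hk : k ≤ n + 1)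
    {G : ℝ → ℝ} (hG : ContDiffOn ℝ (k : ℕ) G I) :
    ContDiffOn ℝ (k : ℕ) (fun l => G (timeOfAffineParam a I l)) (affineParam a '' I) := by
  induction k generalizing G with
  | zero =>
    rw [Nat.cast_zero, contDiffOn_zero] at hG ⊢
    exact hG.comp (fun l hl => (H.hasDerivAt_time l hl).continuousAt.continuousWithinAt) H.time_mem
  | succ k ih =>
    have hG' : ContDiffOn ℝ ((k : WithTop ℕ∞) + 1) G I := by exact_mod_cast hG
    rw [contDiffOn_succ_iff_deriv_of_isOpen H.isOpen] at hG'
    have hd : ∀ l ∈ affineParam a '' I, HasDerivAt (fun l => G (timeOfAffineParam a I l))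
        (deriv G (timeOfAffineParam a I l) * (a (timeOfAffineParam a I l))⁻¹) l := fun l hl =>
      (hG'.1.differentiableAt (H.isOpen.mem_nhds (H.time_mem l hl))).hasDerivAt.comp l
        (H.hasDerivAt_time l hl)
    have hmain : ContDiffOn ℝ ((k : WithTop ℕ∞) + 1) (fun l => G (timeOfAffineParam a I l))
        (affineParam a '' I) := by
      rw [contDiffOn_succ_iff_deriv_of_isOpen H.isOpen_image]
      refine ⟨fun l hl => (hd l hl).differentiableAt.differentiableWithinAt, by simp, ?_⟩
      have hak : ContDiffOn ℝ (k : ℕ) a I := ha.of_le (by exact_mod_cast (by omega : k ≤ n))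
      refine (ih (by omega) (hG'.2.2.mul (hak.inv fun t ht => (H.pos t ht).ne'))).congr
        fun l hl => (hd l hl).deriv
    exact_mod_cast hmain

lemma contDiffOn_hubbleRatio {r : ℕ} (ha : ContDiffOn ℝ ((r + 2 : ℕ) : WithTop ℕ∞) a I) :
    ContDiffOn ℝ (r : ℕ) (hubbleRatio a I) (affineParam a '' I) := by
  have h0 := fun t ht => (H.pos t ht).ne'
  have h1 : ContDiffOn ℝ ((r + 1 : ℕ) : WithTop ℕ∞) (hubble a) I :=
    (ha.deriv_of_isOpen H.isOpen (by norm_cast)).div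
      (ha.of_le (by exact_mod_cast Nat.le_succ _)) h0
  have h2 : ContDiffOn ℝ (r : ℕ) (deriv (hubble a)) I :=
    h1.deriv_of_isOpen H.isOpen (by norm_cast)
  have h3 : ContDiffOn ℝ (r : ℕ) a I := ha.of_le (by exact_mod_cast (by omega : r ≤ r + 2))
  exact H.contDiffOn_comp_time ha (by omega)
    (h2.div (h3.pow 2) fun t ht => pow_ne_zero 2 (h0 t ht))

end IsRegularPast

/-- Points near 0 on the right are interior to the half-line, so there the one-sided agreement is
agreement of two-sided germs. -/
lemma iteratedDeriv_eventuallyEq_right {u v : ℝ → ℝ} (h : u =ᶠ[𝓝[>] 0] v) (r : ℕ) :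
    iteratedDeriv r u =ᶠ[𝓝[>] 0] iteratedDeriv r v := by
  filter_upwards [eventually_eventually_nhdsWithin.2 h, self_mem_nhdsWithin] with l hl hl0
  rw [isOpen_Ioi.nhdsWithin_eq hl0] at hl
  exact EventuallyEq.iteratedDeriv_eq r hl

/-- Smooth functions of a solution of a smooth autonomous differential equation that converges at
`0` have derivatives of all orders that converge at `0`. -/
lemma hasRightLimit_iteratedDeriv_comp {E : Type*} [NormedAddCommGroup E] [NormedSpace ℝ E]
    {p : ℝ → E} {p₀ : E} {V : E → E} (hp : Tendsto p (𝓝[>] 0) (𝓝 p₀)) (hV : ContDiffAt ℝ ∞ V p₀)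
    (hpV : ∀ᶠ l in 𝓝[>] 0, HasDerivAt p (V (p l)) l) (r : ℕ) {Φ : E → ℝ}
    (hΦ : ContDiffAt ℝ ∞ Φ p₀) : HasRightLimit (iteratedDeriv r fun l => Φ (p l)) := by
  induction r generalizing Φ with
  | zero =>
    rw [iteratedDeriv_zero]
    exact ⟨_, hΦ.continuousAt.tendsto.comp hp⟩
  | succ r ih =>
    -- Along the solution the derivative of Φ is DΦ(V), again a function smooth at the limit point,
    -- so the induction runs over all such Φ.
    have h1 : ContDiffAt ℝ ∞ (fun q => fderiv ℝ Φ q (V q)) p₀ :=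
      (hΦ.fderiv_right (m := ∞) (by simp)).clm_apply hV
    have h2 : ∀ᶠ q in 𝓝 p₀, ContDiffAt ℝ 1 Φ q :=
      (hΦ.of_le (by exact_mod_cast le_top)).eventually (by simp)
    obtain ⟨m, hm⟩ := ih h1
    rw [iteratedDeriv_succ']
    refine ⟨m, hm.congr' (iteratedDeriv_eventuallyEq_right ?_ r)⟩
    filter_upwards [hpV, hp.eventually h2] with l hl hl2
    exact ((hl2.differentiableAt (by simp)).hasFDerivAt.comp_hasDerivAt l hl).deriv.symm

lemma IsRegularPast.hasRightLimit_iteratedDeriv_hubbleRatio {a : ℝ → ℝ} {I : Set ℝ}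
    (H : IsRegularPast a I) {q : ℕ} (hq : 2 ≤ q) {f : ℝ → ℝ} (hf : ContDiffAt ℝ ∞ f 0)
    (haf : ∀ᶠ t in atBot, deriv (hubble a) t = a t ^ q * f (a t)) (r : ℕ) :
    HasRightLimit (iteratedDeriv r (hubbleRatio a I)) := by
  -- With m = q - 2 ≥ 0, h = a^m f(a) is smooth in a at 0.
  obtain ⟨m, rfl⟩ := Nat.exists_eq_add_of_le' hq
  obtain ⟨b, hb, hbD⟩ := H.Ioo_subset
  have hD : ∀ᶠ l in 𝓝[>] (0 : ℝ), l ∈ affineParam a '' I :=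
    mem_of_superset (Ioo_mem_nhdsGT hb) hbD
  have hα : Tendsto (scaleAffine a I) (𝓝[>] 0) (𝓝 0) := H.tendsto_scale.comp H.tendsto_time
  have hratio : hubbleRatio a I =ᶠ[𝓝[>] 0] fun l => scaleAffine a I l ^ m * f (scaleAffine a I l) := by
    filter_upwards [hD, H.tendsto_time.eventually haf] with l hl hlf
    have h0 := (H.scaleAffine_pos hl).ne'
    rw [hubbleRatio, hlf]
    change scaleAffine a I l ^ (m + 2) * f (scaleAffine a I l) / scaleAffine a I l ^ 2 = _
    field_simp
    ring
  have hlim : HasRightLimit (hubbleRatio a I) :=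
    ⟨_, ((hα.pow m).mul (hf.continuousAt.tendsto.comp hα)).congr' hratio.symm⟩
  -- Convergence of h yields that of H, so (a, H) tends to (0, h₀), where the vector field (H, h a)
  -- is smooth.
  obtain ⟨h₀, hβ⟩ := (H.hasRightLimit_scale_hubble hlim).2
  have hf' : ContDiffAt ℝ ∞ (fun p : ℝ × ℝ => f p.1) (0, h₀) :=
    ContDiffAt.comp (g := f) (f := Prod.fst) (0, h₀) hf contDiffAt_fst
  obtain ⟨c, hc⟩ := hasRightLimit_iteratedDeriv_comp
    (p := fun l => (scaleAffine a I l, hubbleAffine a I l)) (p₀ := (0, h₀))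
    (V := fun p => (p.2, p.1 ^ m * f p.1 * p.1)) (Φ := fun p => p.1 ^ m * f p.1)
    (hα.prodMk_nhds hβ)
    (contDiffAt_snd.prodMk (((contDiffAt_fst.pow m).mul hf').mul contDiffAt_fst))
    (by
      filter_upwards [hD, hratio] with l hl hlr
      have := H.hasDerivAt_hubbleAffine hl
      rw [hlr] at this
      exact (H.hasDerivAt_scaleAffine hl).prodMk this)
    r ((contDiffAt_fst.pow m).mul hf')
  exact ⟨c, hc.congr' (iteratedDeriv_eventuallyEq_right hratio.symm r)⟩

end FLRW

end

theorem mainTheorem2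
    (I : Set ℝ) (hI_open : IsOpen I) (hI_lower : IsLowerSet I) (hI_ne : I.Nonempty)
    (a : ℝ → ℝ) (ha_pos : ∀ t ∈ I, 0 < a t)
    (abar HL : ℝ) (habar : 0 < abar) (hHL : 0 < HL)
    (hdS : a ~[atBot] fun t => abar * Real.exp (HL * t)) :
    (∀ r : ℕ, ContDiffOn ℝ ((r + 2 : ℕ) : WithTop ℕ∞) a I →
      (Tendsto (fun lam => |iteratedDeriv r (FLRW.hubbleRatio a I) lam|) (𝓝[>] 0) atTop →
        FLRW.IsPPCurvatureSingularity (FLRW.flrwMetric a) (FLRW.flrwRegion I)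
            FLRW.pastBoundary r ∧
          ¬ FLRW.IsExtendible (FLRW.flrwMetric a) (FLRW.flrwRegion I) FLRW.pastBoundary r) ∧
      ((∃ L : ℝ, Tendsto (iteratedDeriv r (FLRW.hubbleRatio a I)) (𝓝[>] 0) (𝓝 L)) →
        ¬ FLRW.IsPPCurvatureSingularity (FLRW.flrwMetric a) (FLRW.flrwRegion I)
            FLRW.pastBoundary r ∧
          FLRW.IsExtendible (FLRW.flrwMetric a) (FLRW.flrwRegion I) FLRW.pastBoundary r)) ∧
    (ContDiffOn ℝ ∞ a I →
      ∀ q : ℕ, 2 ≤ q → ∀ f : ℝ → ℝ, ContDiffAt ℝ ∞ f 0 →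
        (∀ᶠ t in atBot, deriv (FLRW.hubble a) t = a t ^ q * f (a t)) →
        FLRW.IsSmoothlyExtendible (FLRW.flrwMetric a) (FLRW.flrwRegion I)
          FLRW.pastBoundary) := by
  have hreg : ∀ {r : ℕ}, ContDiffOn ℝ ((r + 2 : ℕ) : WithTop ℕ∞) a I → FLRW.IsRegularPast a I :=
    fun {r} ha => FLRW.isRegularPast hI_open hI_lower hI_ne ha_pos hHL hdS
      (ha.of_le (by exact_mod_cast Nat.le_add_left 2 r))
  refine ⟨fun r ha => ⟨fun hlim => ?_, fun hlim => ?_⟩, fun ha q hq f hf haf r => ?_⟩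
  · have h := (hreg ha).isPPCurvatureSingularity ((hreg ha).contDiffOn_hubbleRatio ha) hlim
    exact ⟨h, not_not_intro h⟩
  · have h := (hreg ha).isExtendible ((hreg ha).contDiffOn_hubbleRatio ha) hlim
    exact ⟨h, h⟩
  · have har : ContDiffOn ℝ ((r + 2 : ℕ) : WithTop ℕ∞) a I := contDiffOn_infty.1 ha (r + 2)
    exact (hreg har).isExtendible ((hreg har).contDiffOn_hubbleRatio har)
      ((hreg har).hasRightLimit_iteratedDeriv_hubbleRatio hq hf haf r)
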